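/- Work over $\mathbb{C}$. A superalgebra $J=J_0\oplus J_1$ is of type $(m,n)$ if $\dim J_0=m$ and $\dim J_1=n$; $|x|\in\mathbb{Z}_2$ denotes the parity of a homogeneous element. $J$ is a Jordan superalgebra if for all homogeneous $w,x,y,z$ one has $xy=(-1)^{|x||y|}yx$ and $$(wx)(yz)+(-1)^{|x||y|}(wy)(xz)+(-1)^{(|x|+|y|)|z|}(wz)(xy)-(-1)^{|w||x|}x(w(yz))-(-1)^{|y|(|w|+|x|)}y(w(xz))-(-1)^{|z|(|w|+|x|+|y|)}z(w(xy))=0 .$$ It is nilpotent if $J^k=0$ for some $k\ge 1$, where $J^1=J$ and $J^{k+1}=J^kJ+J^{k-1}J^2+\cdots+JJ^k$. Fix a homogeneous basis $e_1,\dots,e_m$ (even), $f_1,\dots,f_n$ (odd). A supercommutative product is given by structure constants $(c_{ij}^k,\rho_{ij}^k,\Gamma_{ij}^k)\in\mathbb{C}^{m^3+2mn^2}$, where $e_ie_j=\sum_k c_{ij}^ke_k$, $e_if_j=f_je_i=\sum_k\rho_{ij}^kf_k$, $f_if_j=\sum_k\Gamma_{ij}^ke_k$. Let $\mathcal{NJS}^{(m,n)}\subseteq\mathbb{C}^{m^3+2mn^2}$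 be the set of those that define a nilpotent Jordan superalgebra, with the Zariski topology. The group $\mathrm{GL}_m(\mathbb{C})\times\mathrm{GL}_n(\mathbb{C})$ acts by change of basis; $O(J)$ is the orbit of $J$ and $\overline{O(J)}$ its Zariski closure. $J\in\mathcal{NJS}^{(m,n)}$ is called rigid if $O(J)$ is Zariski open in $\mathcal{NJS}^{(m,n)}$. Consider the following superalgebras of type $(1,4)$, where products of basis vectors that are neither listed nor obtained from the listed ones by supercommutativity are zero: - $(1,4)_3$: $f_1f_2=e_1,\ f_3f_4=e_1$; - $(1,4)_6$: $e_1f_2=f_1,\ f_3f_4=e_1$; - $(1,4)_7$: $e_1f_2=f_1,\ e_1f_3=f_2$; - $(1,4)_9$: $e_1f_2=f_1,\ e_1f_4=f_3,\ f_2f_4=e_1$. **Theorem.** The variety $\mathcal{NJS}^{(1,4)}$ has exactly four irreducible components, namely $$\overline{O((1,4)_3)},\quad \overline{O((1,4)_6)},\quad \overline{O((1,4)_7)},\quad \overline{O((1,4)_9)} .$$ Moreover, a superalgebra $J\in\mathcal{NJS}^{(1,4)}$ is rigid if and only if it lies in the orbit of (that is, is isomorphic to) one of $(1,4)_3,(1,4)_6,(1,4)_7,(1,4)_9$.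 -/

import Mathlib

open scoped BigOperators

namespace JordanSuper

/-- Structure constants of a supercommutative product on a graded space with even basis
`e_1, …, e_m` and odd basis `f_1, …, f_n`:
`e_i e_j = ∑ k, c i j k • e_k`, `e_i f_j = ∑ k, ρ i j k • f_k`, `f_i f_j = ∑ k, Γ i j k • e_k`.
This is the affine space `ℂ ^ (m³ + 2 m n²)`. (Indices start from `0`.) -/
@[ext] structure StructureConstants (m n : ℕ) where
  c : Fin m → Fin m → Fin m → ℂ
  ρ : Fin m → Fin n → Fin n → ℂ
  Γ : Fin n → Fin n → Fin m → ℂ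

/-- The index set of the coordinates of the affine space of structure constants. -/
abbrev Coord (m n : ℕ) : Type :=
  (Fin m × Fin m × Fin m) ⊕ (Fin m × Fin n × Fin n) ⊕ (Fin n × Fin n × Fin m)

/-- The coordinates of a point of the affine space of structure constants. -/
def StructureConstants.coords {m n : ℕ} (J : StructureConstants m n) : Coord m n → ℂ
  | .inl (i, j, k) => J.c i j k
  | .inr (.inl (i, j, k)) => J.ρ i j k
  | .inr (.inr (i, j, k)) => J.Γ i j k

/-- The set of points at which all polynomials of an ideal vanish. -/
def zeros {m n : ℕ} (I : Ideal (MvPolynomial (Coord m n) ℂ)) : Set (StructureConstants m n) :=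
  {J | ∀ p ∈ I, MvPolynomial.eval J.coords p = 0}

/-- The Zariski topology: the closed sets are the common zero sets of polynomials in the
structure constants. -/
instance zariskiTopology (m n : ℕ) : TopologicalSpace (StructureConstants m n) :=
  TopologicalSpace.ofClosed (Set.range zeros)
    ⟨⊤, by
      ext J
      simp only [zeros, Set.mem_ofPred_eq, Set.mem_empty_iff_false, iff_false]
      intro h
      simpa using h 1 trivial⟩
    (by
      intro A hA
      refine ⟨sSup {I | zeros I ∈ A}, ?_⟩
      ext J
      constructor
      · intro h s hs
        obtain ⟨I, rfl⟩ := hA hs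
        exact fun p hp => h p ((le_sSup (a := I) hs) hp)
      · intro h
        have hle : sSup {I | zeros I ∈ A} ≤ RingHom.ker (MvPolynomial.eval J.coords) :=
          sSup_le fun I hI p hp => h _ hI p hp
        exact fun p hp => hle hp)
    (by
      rintro _ ⟨I, rfl⟩ _ ⟨K, rfl⟩
      refine ⟨I * K, ?_⟩
      ext J
      constructor
      · intro h
        by_contra hJ
        simp only [zeros, Set.mem_union, Set.mem_ofPred_eq, not_or, not_forall] at hJ
        obtain ⟨⟨p, hp, hp0⟩, q, hq, hq0⟩ := hJ
        have := h _ (Ideal.mul_mem_mul hp hq)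
        rw [map_mul] at this
        exact (mul_ne_zero hp0 hq0) this
      · rintro (h | h) p hp
        · exact h p (Ideal.mul_le_left hp)
        · exact h p (Ideal.mul_le_right hp))

/-- The underlying vector space `V = V₀ ⊕ V₁`, with `dim V₀ = m` and `dim V₁ = n`. -/
abbrev V (m n : ℕ) : Type := (Fin m → ℂ) × (Fin n → ℂ)

/-- The even basis vector `e_i`. -/
def e {m n : ℕ} (i : Fin m) : V m n := (Pi.single i 1, 0)

/-- The odd basis vector `f_j`. -/
def f {m n : ℕ} (j : Fin n) : V m n := (0, Pi.single j 1)

/-- The homogeneous components `V₀` and `V₁`. -/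
def homogeneous (m n : ℕ) (p : ZMod 2) : Submodule ℂ (V m n) :=
  if p = 0 then LinearMap.range (LinearMap.inl ℂ (Fin m → ℂ) (Fin n → ℂ))
  else LinearMap.range (LinearMap.inr ℂ (Fin m → ℂ) (Fin n → ℂ))

/-- The bilinear product on `V` with the given structure constants, where `f_j e_i = e_i f_j`. -/
def mul {m n : ℕ} (J : StructureConstants m n) : V m n →ₗ[ℂ] V m n →ₗ[ℂ] V m n :=
  LinearMap.mk₂ ℂ
    (fun x y =>
      (fun k => (∑ i, ∑ j, x.1 i * y.1 j * J.c i j k) + ∑ i, ∑ j, x.2 i * y.2 j * J.Γ i j k,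
       fun k => ∑ i, ∑ j, (x.1 i * y.2 j + y.1 i * x.2 j) * J.ρ i j k))
    (by
      intro x x' y
      ext k <;> simp [add_mul, Finset.sum_add_distrib, mul_add] <;> ring)
    (by
      intro a x y
      ext k <;> simp [Finset.mul_sum, mul_add, add_mul, mul_assoc, mul_left_comm])
    (by
      intro x y y'
      ext k <;> simp [add_mul, Finset.sum_add_distrib, mul_add] <;> ring)
    (by
      intro a x y
      ext k <;> simp [Finset.mul_sum, mul_add, add_mul, mul_assoc, mul_left_comm])

/-- The sign `(-1)^p`. -/
def sgn (p : ZMod 2) : ℂ := (-1) ^ p.val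

/-- The structure constants define a Jordan superalgebra: the product is supercommutative and
satisfies the Jordan superidentity on homogeneous elements. (`a`, `b`, `c`, `d` are the parities
of `w`, `x`, `y`, `z`.) -/
def IsJordan {m n : ℕ} (J : StructureConstants m n) : Prop :=
  (∀ (p q : ZMod 2), ∀ x ∈ homogeneous m n p, ∀ y ∈ homogeneous m n q,
    mul J x y = sgn (p * q) • mul J y x) ∧
  (∀ (a b c d : ZMod 2), ∀ w ∈ homogeneous m n a, ∀ x ∈ homogeneous m n b,
    ∀ y ∈ homogeneous m n c, ∀ z ∈ homogeneous m n d,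
    mul J (mul J w x) (mul J y z)
      + sgn (b * c) • mul J (mul J w y) (mul J x z)
      + sgn ((b + c) * d) • mul J (mul J w z) (mul J x y)
      - sgn (a * b) • mul J x (mul J w (mul J y z))
      - sgn (c * (a + b)) • mul J y (mul J w (mul J x z))
      - sgn (d * (a + b + c)) • mul J z (mul J w (mul J x y)) = 0)

/-- The powers `J^1 = J`, `J^(k+1) = J^k J + J^(k-1) J^2 + ⋯ + J J^k`, where the product of two
subspaces is the span of the products of their elements. (The value at exponent `0` is not used.) -/
def power {m n : ℕ} (J : StructureConstants m n) : ℕ → Submodule ℂ (V m n)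
  | 0 => ⊤
  | 1 => ⊤
  | k + 2 => ⨆ i : Fin (k + 1),
      Submodule.map₂ (mul J) (power J (i.val + 1)) (power J (k + 1 - i.val))
  decreasing_by all_goals omega

/-- Nilpotency: `J^k = 0` for some positive `k`. -/
def IsNilpotentSuper {m n : ℕ} (J : StructureConstants m n) : Prop :=
  ∃ k : ℕ, 1 ≤ k ∧ power J k = ⊥

/-- The variety of Jordan superalgebras of type `(m, n)`. -/
def JS (m n : ℕ) : Set (StructureConstants m n) := {J | IsJordan J}

/-- The variety of nilpotent Jordan superalgebras of type `(m, n)`. -/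
def NJS (m n : ℕ) : Set (StructureConstants m n) := {J | J ∈ JS m n ∧ IsNilpotentSuper J}

/-- The graded linear map `T ⊕ S` on `V` given by a pair `(T, S)` of invertible matrices. -/
def gradedMap {m n : ℕ} (g : GL (Fin m) ℂ × GL (Fin n) ℂ) : V m n →ₗ[ℂ] V m n :=
  (Matrix.toLin' (g.1 : Matrix (Fin m) (Fin m) ℂ)).prodMap
    (Matrix.toLin' (g.2 : Matrix (Fin n) (Fin n) ℂ))

/-- The action of `GL_m × GL_n` by change of basis: `g • J` has the structure constants of the
product `(x, y) ↦ g ((g⁻¹ x) (g⁻¹ y))`. -/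
def act {m n : ℕ} (g : GL (Fin m) ℂ × GL (Fin n) ℂ) (J : StructureConstants m n) :
    StructureConstants m n where
  c i j k := (gradedMap g (mul J (gradedMap g⁻¹ (e i)) (gradedMap g⁻¹ (e j)))).1 k
  ρ i j k := (gradedMap g (mul J (gradedMap g⁻¹ (e i)) (gradedMap g⁻¹ (f j)))).2 k
  Γ i j k := (gradedMap g (mul J (gradedMap g⁻¹ (f i)) (gradedMap g⁻¹ (f j)))).1 k

/-- The orbit `O(J)` of `J` under `GL_m × GL_n`. -/
def orbit {m n : ℕ} (J : StructureConstants m n) : Set (StructureConstants m n) :=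
  Set.range fun g : GL (Fin m) ℂ × GL (Fin n) ℂ => act g J

/-- `J` is rigid in `X`: it is a point of `X` and its orbit is Zariski open in `X`. -/
def IsRigidIn {m n : ℕ} (X : Set (StructureConstants m n)) (J : StructureConstants m n) : Prop :=
  J ∈ X ∧ orbit J ⊆ X ∧ IsOpen ((↑) ⁻¹' orbit J : Set X)

/-- The point of type `(1, 4)` with `e_1 e_1 = 0`, `e_1 f_j = ∑ k, A j k • f_k` and
`f_i f_j = B i j • e_1`. -/
def type14 (A B : Matrix (Fin 4) (Fin 4) ℂ) : StructureConstants 1 4 where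
  c _ _ _ := 0
  ρ _ j k := A j k
  Γ i j _ := B i j

/-- The elementary skew-symmetric matrix with entry `1` at `(i, j)` and `-1` at `(j, i)`. -/
def skew (i j : Fin 4) : Matrix (Fin 4) (Fin 4) ℂ := Matrix.single i j 1 - Matrix.single j i 1

/-- `f_1 f_2 = e_1`, `f_3 f_4 = e_1`. -/
def J14_3 : StructureConstants 1 4 := type14 0 (skew 0 1 + skew 2 3)

/-- `e_1 f_2 = f_1`, `f_3 f_4 = e_1`. -/
def J14_6 : StructureConstants 1 4 := type14 (Matrix.single 1 0 1) (skew 2 3)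

/-- `e_1 f_2 = f_1`, `e_1 f_3 = f_2`. -/
def J14_7 : StructureConstants 1 4 := type14 (Matrix.single 1 0 1 + Matrix.single 2 1 1) 0

/-- `e_1 f_2 = f_1`, `e_1 f_4 = f_3`, `f_2 f_4 = e_1`. -/
def J14_9 : StructureConstants 1 4 :=
  type14 (Matrix.single 1 0 1 + Matrix.single 3 2 1) (skew 1 3)

end JordanSuper

/-! When the even part is one-dimensional, an algebra consists of a scalar `c`, a matrix `A`
(multiplication by `e_1` on the odd part, acting on row vectors) and a matrix `B` (the product of
odd elements). It is nilpotent Jordan exactly when `c = 0`, `B` is skew, `A³ = 0`, `AB = 0`, and `A²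
= 0` or `B = 0` (`mem_NJS_iff`). In particular the variety is closed.

Inside the variety each of the four orbits is the locus where some polynomials do not all vanish:
`det B ≠ 0` for `J14_3`, `ω ∧ L ≠ 0` for `J14_6` (`ω` the form `B`, `L` the map `A`), `A² ≠ 0` for
`J14_7`, and `rank A ≥ 2`, `B ≠ 0` for `J14_9` (`mem_orbit_14_3_iff` and its analogues). So these
orbits are open, and the same invariants show that they are disjoint.

Their closures cover the variety (`IsNJ.mem_closure`). If `A = 0`, the skew form `B` is a limit of
nondegenerate ones. If `B = 0`, then `A` is a limit of nilpotent matrices of index 3. If both are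
nonzero, `AB = 0` forces `rank B = 2`, and `A` acts on the radical of `B` either nontrivially (the
orbit of `J14_6`) or by zero (a limit of `J14_9`).

Each orbit is irreducible, being parametrized polynomially by an open subset of an affine space.
General topology then identifies the components (`irreducibleComponents_of_open_cover`). A rigid
algebra lies in one of the four closures, so its open orbit meets the corresponding dense orbit and
equals it. -/

namespace JordanSuper

open Matrix

/-! ### Nilpotent Jordan superalgebras with one-dimensional even part as matrix equations. -/

/-- The matrix of the multiplication by `e_1` on the odd part, acting on row vectors. -/
def oddMatrix {n : ℕ} (J : StructureConstants 1 n) : Matrix (Fin n) (Fin n) ℂ :=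
  Matrix.of fun j k => J.ρ 0 j k

/-- The Gram matrix of the product of odd elements. -/
def formMatrix {n : ℕ} (J : StructureConstants 1 n) : Matrix (Fin n) (Fin n) ℂ :=
  Matrix.of fun i j => J.Γ i j 0

lemma mul_eq {n : ℕ} (J : StructureConstants 1 n) (x y : V 1 n) :
    mul J x y =
      (fun _ => x.1 0 * y.1 0 * J.c 0 0 0 + x.2 ⬝ᵥ (formMatrix J *ᵥ y.2),
       x.1 0 • (y.2 ᵥ* oddMatrix J) + y.1 0 • (x.2 ᵥ* oddMatrix J)) := by
  ext k
  · obtain rfl : k = 0 := Subsingleton.elim _ _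
    simp [mul, formMatrix, dotProduct, mulVec, Finset.mul_sum, mul_assoc, mul_comm]
  · simp [mul, oddMatrix, vecMul, dotProduct, Finset.mul_sum, add_mul, Finset.sum_add_distrib,
      mul_assoc]

lemma mem_homogeneous_zero {m n : ℕ} {x : V m n} : x ∈ homogeneous m n 0 ↔ x.2 = 0 := by
  simp only [homogeneous, if_true, LinearMap.mem_range, LinearMap.inl_apply]
  exact ⟨by rintro ⟨y, rfl⟩; rfl, fun h => ⟨x.1, by ext <;> simp [h]⟩⟩

lemma mem_homogeneous_one {m n : ℕ} {x : V m n} : x ∈ homogeneous m n 1 ↔ x.1 = 0 := by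
  simp only [homogeneous, one_ne_zero, if_false, LinearMap.mem_range, LinearMap.inr_apply]
  exact ⟨by rintro ⟨y, rfl⟩; rfl, fun h => ⟨x.2, by ext <;> simp [h]⟩⟩

lemma e_mem {m n : ℕ} (i : Fin m) : (e i : V m n) ∈ homogeneous m n 0 :=
  mem_homogeneous_zero.2 rfl

lemma f_mem {m n : ℕ} (i : Fin n) : (f i : V m n) ∈ homogeneous m n 1 :=
  mem_homogeneous_one.2 rfl

lemma sgn_zero : sgn 0 = 1 := by simp [sgn]

lemma sgn_one : sgn 1 = -1 := by simp [sgn, ZMod.val_one]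

/-- The summand `J · J^k` of `J^(k+1)` keeps such a `W` inside every power. Nilpotency thus excludes
a nonzero `W ⊆ J · W`, which is how it is exploited below. -/
lemma le_power_of_le_map₂ {m n : ℕ} (J : StructureConstants m n) {W : Submodule ℂ (V m n)}
    (hW : W ≤ Submodule.map₂ (mul J) ⊤ W) (k : ℕ) : W ≤ power J (k + 1) := by
  induction k with
  | zero => rw [power]; exact le_top
  | succ k ih =>
    rw [power]
    refine le_trans hW (le_trans ?_ (le_iSup _ (0 : Fin (k + 1))))
    have : power J ((0 : Fin (k + 1)).val + 1) = ⊤ := by simp [power]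
    rw [this]
    exact Submodule.map₂_le_map₂_right ih

lemma eq_bot_of_le_map₂ {m n : ℕ} {J : StructureConstants m n} (hJ : IsNilpotentSuper J)
    {W : Submodule ℂ (V m n)} (hW : W ≤ Submodule.map₂ (mul J) ⊤ W) : W = ⊥ := by
  obtain ⟨k, hk, h⟩ := hJ
  obtain ⟨k, rfl⟩ : ∃ l, k = l + 1 := ⟨k - 1, by omega⟩
  exact le_bot_iff.1 (h ▸ le_power_of_le_map₂ J hW k)

lemma e_ne_zero {n : ℕ} : (e 0 : V 1 n) ≠ 0 := by
  intro h
  simpa [e] using congrFun (congrArg Prod.fst h) 0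

lemma IsNilpotentSuper.c_eq_zero {n : ℕ} {J : StructureConstants 1 n} (hJ : IsNilpotentSuper J) :
    J.c 0 0 0 = 0 := by
  by_contra hc
  have h := eq_bot_of_le_map₂ hJ (W := Submodule.span ℂ {e 0}) (by
    rw [Submodule.span_singleton_le_iff_mem]
    have hm : mul J (e 0) (e 0) = J.c 0 0 0 • e 0 := by
      rw [mul_eq]
      ext k
      · simp [e, Subsingleton.elim k 0]
      · simp [e]
    have := Submodule.apply_mem_map₂ (mul J) (Submodule.mem_top (x := e 0))
      (Submodule.mem_span_singleton_self (R := ℂ) (e 0 : V 1 n))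
    rw [hm] at this
    exact (Submodule.smul_mem_iff _ hc).1 this)
  exact e_ne_zero (Submodule.span_singleton_eq_bot.1 h)

/-- If `u (v e_1) = λ e_1` with `λ ≠ 0`, then `e_1` and `v e_1` reproduce each other under
multiplication, so their span survives in all powers. This yields `AB = 0` from nilpotency without
the Jordan identity. -/
lemma IsNilpotentSuper.form_vecMul_eq_zero {n : ℕ} {J : StructureConstants 1 n}
    (hJ : IsNilpotentSuper J) (u v : Fin n → ℂ) :
    u ⬝ᵥ (formMatrix J *ᵥ (v ᵥ* oddMatrix J)) = 0 := by
  by_contra hc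
  have h1 : mul J (0, v) (e 0) = (0, v ᵥ* oddMatrix J) := by
    rw [mul_eq]
    ext k <;> simp [e]
  have h2 : mul J (0, u) (0, v ᵥ* oddMatrix J) =
      (u ⬝ᵥ (formMatrix J *ᵥ (v ᵥ* oddMatrix J))) • e 0 := by
    rw [mul_eq]
    ext k
    · simp [e, Subsingleton.elim k 0]
    · simp [e]
  have h := eq_bot_of_le_map₂ hJ (W := Submodule.span ℂ {e 0, (0, v ᵥ* oddMatrix J)}) (by
    rw [Submodule.span_le]
    rintro x (rfl | rfl)
    · have := Submodule.apply_mem_map₂ (mul J) (Submodule.mem_top (x := (0, u)))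
        (Submodule.subset_span (R := ℂ)
          (show (0, v ᵥ* oddMatrix J) ∈ ({e 0, (0, v ᵥ* oddMatrix J)} : Set (V 1 n)) by simp))
      rw [h2] at this
      exact (Submodule.smul_mem_iff _ hc).1 this
    · have := Submodule.apply_mem_map₂ (mul J) (Submodule.mem_top (x := (0, v)))
        (Submodule.subset_span (R := ℂ)
          (show e 0 ∈ ({e 0, (0, v ᵥ* oddMatrix J)} : Set (V 1 n)) by simp))
      rwa [h1] at this)
  refine e_ne_zero (n := n) ((Submodule.mem_bot ℂ).1 (h ▸ Submodule.subset_span ?_))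
  simp

/-- The matrix equations that define the nilpotent Jordan superalgebras with one-dimensional even
part: `A` is the multiplication by `e_1` and `B` the product of odd elements. -/
structure IsNJ {n : ℕ} (A B : Matrix (Fin n) (Fin n) ℂ) : Prop where
  skew : Bᵀ = -B
  cube : A * A * A = 0
  mul_form : A * B = 0
  square : A * A = 0 ∨ B = 0

lemma IsNJ.of_isJordan {n : ℕ} {J : StructureConstants 1 n} (hJ : IsJordan J)
    (hN : IsNilpotentSuper J) : IsNJ (oddMatrix J) (formMatrix J) := by
  have hc := hN.c_eq_zero
  have hAB' := hN.form_vecMul_eq_zero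
  obtain ⟨hcomm, hjord⟩ := hJ
  set A := oddMatrix J with hA
  set B := formMatrix J with hB
  have hskew : ∀ i j, B i j = - B j i := by
    intro i j
    have h := hcomm 1 1 (f i) (f_mem i) (f j) (f_mem j)
    rw [mul_eq, mul_eq] at h
    have := congrFun (congrArg Prod.fst h) 0
    simpa [f, sgn_one] using this
  have hT : Bᵀ = -B := by
    ext i j
    simpa using hskew j i
  have hAB : A * B = 0 := by
    ext i j
    have := hAB' (Pi.single j 1) (Pi.single i 1)
    rw [← vecMul_transpose, hT, vecMul_vecMul, single_one_dotProduct, single_one_vecMul] at this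
    simpa using this
  have hrow : ∀ (M : Matrix (Fin n) (Fin n) ℂ) (j k : Fin n),
      (A.row j ᵥ* M) k = (A * M) j k := fun M j k => rfl
  have hBA : ∀ i j, (B *ᵥ A.row j) i = 0 := fun i j => by
    rw [← vecMul_transpose, hT, vecMul_neg, Pi.neg_apply, hrow, hAB]
    simp
  refine ⟨hT, ?_, hAB, ?_⟩
  · ext j k
    -- As `e_1 e_1 = 0`, only two terms remain, both equal to `-e_1(e_1(e_1 f_j))`; hence the factor
    -- `-1/2` below.
    have h := hjord 0 0 0 1 (e 0) (e_mem 0) (e 0) (e_mem 0) (e 0) (e_mem 0) (f j) (f_mem j)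
    have h2 := congrFun (congrArg Prod.snd h) k
    simp only [mul_eq, ← hA, ← hB, hc] at h2
    simp [e, f, sgn_zero] at h2
    rw [hrow] at h2
    rw [mul_assoc, Matrix.zero_apply]
    linear_combination (-1 / 2 : ℂ) * h2
  -- Terms `f (f (e_1 f))` vanish by `AB = 0`, and the terms in `B j k` cancel. Taking equal indices
  -- in `key` kills row `j` of `A²` whenever some `B i j ≠ 0`; then `key` kills every row.
  · have key : ∀ i j k l, B i j * (A * A) k l = B i k * (A * A) j l := by
      intro i j k l
      have h := hjord 1 0 1 1 (f i) (f_mem i) (e 0) (e_mem 0) (f j) (f_mem j) (f k) (f_mem k)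
      have h2 := congrFun (congrArg Prod.snd h) l
      simp only [mul_eq, ← hA, ← hB, hc] at h2
      simp [e, f, sgn_zero, sgn_one] at h2
      rw [hBA, hBA, smul_vecMul] at h2
      simp only [hrow, Pi.smul_apply, smul_eq_mul] at h2
      linear_combination h2
    by_contra! hne
    obtain ⟨hA2, hB0⟩ := hne
    obtain ⟨i, j, hij⟩ : ∃ i j, B i j ≠ 0 := by
      by_contra! h0
      exact hB0 (by ext i j; exact h0 i j)
    have hd : ∀ i, B i i = 0 := fun i => by
      have := hskew i i
      exact self_eq_neg.1 this
    have hj : ∀ l, (A * A) j l = 0 := fun l => by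
      have := key j i j l
      rw [hd, zero_mul, hskew j i] at this
      simpa [hij] using this
    apply hA2
    ext k l
    have := key i j k l
    rw [hj, mul_zero] at this
    simpa [hij] using this

lemma IsNJ.mulVec_vecMul {n : ℕ} {A B : Matrix (Fin n) (Fin n) ℂ} (h : IsNJ A B)
    (v : Fin n → ℂ) : B *ᵥ (v ᵥ* A) = 0 := by
  rw [← vecMul_transpose, h.skew, vecMul_neg, vecMul_vecMul, h.mul_form, vecMul_zero, neg_zero]

/-- Products of two products vanish. -/
lemma IsNJ.mul_mul_mul {n : ℕ} {J : StructureConstants 1 n} (hc : J.c 0 0 0 = 0)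
    (h : IsNJ (oddMatrix J) (formMatrix J)) (w x y z : V 1 n) :
    mul J (mul J w x) (mul J y z) = 0 := by
  simp only [mul_eq, hc, mul_zero, zero_add, mulVec_add, mulVec_smul, h.mulVec_vecMul, smul_zero,
    dotProduct_zero, add_vecMul, smul_vecMul, smul_add, vecMul_vecMul]
  rcases h.square with h0 | h0 <;> ext k <;> simp [h0]

/-- Products of type `x (w (y z))` vanish. -/
lemma IsNJ.mul_mul_mul' {n : ℕ} {J : StructureConstants 1 n} (hc : J.c 0 0 0 = 0)
    (h : IsNJ (oddMatrix J) (formMatrix J)) (w x y z : V 1 n) :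
    mul J x (mul J w (mul J y z)) = 0 := by
  simp only [mul_eq, hc, mul_zero, zero_add, mulVec_add, mulVec_smul, h.mulVec_vecMul, smul_zero,
    dotProduct_zero, add_vecMul, smul_vecMul, smul_add, zero_smul, add_zero, vecMul_vecMul, h.cube]
  rcases h.square with h0 | h0 <;> ext k <;> simp [h0]

lemma IsNJ.isJordan {n : ℕ} {J : StructureConstants 1 n} (hc : J.c 0 0 0 = 0)
    (h : IsNJ (oddMatrix J) (formMatrix J)) : IsJordan J := by
  refine ⟨fun p q x hx y hy => ?_, fun a b c d w _ x _ y _ z _ => ?_⟩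
  · have hs : x.2 ⬝ᵥ (formMatrix J *ᵥ y.2) = - (y.2 ⬝ᵥ (formMatrix J *ᵥ x.2)) := by
      rw [← vecMul_transpose, h.skew, vecMul_neg, dotProduct_neg, dotProduct_comm,
        ← dotProduct_mulVec]
    rw [mul_eq, mul_eq, hs, hc]
    have h01 : ∀ r : ZMod 2, r = 0 ∨ r = 1 := by decide
    obtain rfl | rfl := h01 p <;> obtain rfl | rfl := h01 q <;>
      simp only [mem_homogeneous_one, mem_homogeneous_zero] at hx hy <;>
      ext k <;> simp [hx, hy, sgn_zero, sgn_one, add_comm]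
  · simp [h.mul_mul_mul hc, h.mul_mul_mul' hc]

lemma power_succ_succ_le {m n : ℕ} {J : StructureConstants m n} {k : ℕ} {F : Submodule ℂ (V m n)}
    (h : ∀ i j, i + j = k → ∀ x ∈ power J (i + 1), ∀ y ∈ power J (j + 1), mul J x y ∈ F) :
    power J (k + 2) ≤ F := by
  rw [power]
  refine iSup_le fun i => Submodule.map₂_le.2 fun x hx y hy => ?_
  refine h i (k - i) (by omega) x hx y ?_
  rwa [show k + 1 - i.val = k - i.val + 1 by omega] at hy

/-- The elements of `V` whose even part lies in `E` and whose odd part is annihilated by `M` and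
`N`. -/
def annihilated {n : ℕ} (E : Submodule ℂ (Fin 1 → ℂ)) (M N : Matrix (Fin n) (Fin n) ℂ) :
    Submodule ℂ (V 1 n) :=
  E.prod (LinearMap.ker M.vecMulLinear ⊓ LinearMap.ker N.vecMulLinear)

lemma mem_annihilated {n : ℕ} {E : Submodule ℂ (Fin 1 → ℂ)} {M N : Matrix (Fin n) (Fin n) ℂ}
    {x : V 1 n} : x ∈ annihilated E M N ↔ x.1 ∈ E ∧ x.2 ᵥ* M = 0 ∧ x.2 ᵥ* N = 0 := Iff.rfl

/-- The odd part of `J²` is killed by `B` and `A²`. In `J³` the even part also disappears, and `J⁴`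
and `J⁵` lie in the annihilator of the algebra. All products contributing to `J⁶` then vanish, `J³
J³` because its factors are odd and `B` kills them. -/
lemma IsNJ.isNilpotentSuper {n : ℕ} {J : StructureConstants 1 n} (hc : J.c 0 0 0 = 0)
    (h : IsNJ (oddMatrix J) (formMatrix J)) : IsNilpotentSuper J := by
  set A := oddMatrix J with hA
  set B := formMatrix J with hB
  have hmul : ∀ x y : V 1 n, mul J x y = (fun _ => x.2 ⬝ᵥ (B *ᵥ y.2),
      x.1 0 • (y.2 ᵥ* A) + y.1 0 • (x.2 ᵥ* A)) := fun x y => by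
    rw [mul_eq, hc]; simp [hA, hB]
  have hBv : ∀ v, v ᵥ* B = 0 → B *ᵥ v = 0 := fun v hv => by
    rw [← vecMul_transpose, h.skew, vecMul_neg, hv, neg_zero]
  have h2 : power J 2 ≤ annihilated ⊤ B (A * A) := by
    refine power_succ_succ_le (k := 0) fun i j hij x hx y hy => ?_
    rw [hmul, mem_annihilated]
    refine ⟨trivial, ?_, ?_⟩ <;>
      simp [add_vecMul, smul_vecMul, vecMul_vecMul, h.mul_form, ← mul_assoc, h.cube]
  have h3 : power J 3 ≤ annihilated ⊥ B (A * A) := by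
    refine power_succ_succ_le (k := 1) fun i j hij x hx y hy => ?_
    rw [hmul, mem_annihilated]
    refine ⟨?_, ?_, ?_⟩
    · obtain ⟨rfl, rfl⟩ | ⟨rfl, rfl⟩ : i = 1 ∧ j = 0 ∨ i = 0 ∧ j = 1 := by omega
      · have hx := (mem_annihilated.1 (h2 hx)).2.1
        rw [dotProduct_mulVec, hx, zero_dotProduct]
        rfl
      · have hy := (mem_annihilated.1 (h2 hy)).2.1
        rw [hBv _ hy, dotProduct_zero]
        rfl
    all_goals simp [add_vecMul, smul_vecMul, vecMul_vecMul, h.mul_form, ← mul_assoc, h.cube]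
  have h4 : power J 4 ≤ annihilated ⊥ B A := by
    refine power_succ_succ_le (k := 2) fun i j hij x hx y hy => ?_
    rw [hmul, mem_annihilated]
    have hx0 : 1 ≤ i → x.2 ᵥ* (A * A) = 0 ∧ x.2 ᵥ* B = 0 := fun hi => by
      obtain rfl | rfl : i = 1 ∨ i = 2 := by omega
      · exact (mem_annihilated.1 (h2 hx)).2.symm
      · exact (mem_annihilated.1 (h3 hx)).2.symm
    have hy0 : 1 ≤ j → y.2 ᵥ* (A * A) = 0 ∧ y.2 ᵥ* B = 0 := fun hi => by
      obtain rfl | rfl : j = 1 ∨ j = 2 := by omega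
      · exact (mem_annihilated.1 (h2 hy)).2.symm
      · exact (mem_annihilated.1 (h3 hy)).2.symm
    obtain ⟨rfl, rfl⟩ | ⟨rfl, rfl⟩ | ⟨rfl, rfl⟩ :
        i = 2 ∧ j = 0 ∨ i = 1 ∧ j = 1 ∨ i = 0 ∧ j = 2 := by omega
    · have hx1 : x.1 = 0 := (mem_annihilated.1 (h3 hx)).1
      obtain ⟨hx2, hx3⟩ := hx0 (by norm_num)
      refine ⟨?_, ?_, ?_⟩
      · rw [dotProduct_mulVec, hx3, zero_dotProduct]
        rfl
      all_goals simp [smul_vecMul, vecMul_vecMul, h.mul_form, hx1, hx2]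
    · obtain ⟨hx2, hx3⟩ := hx0 le_rfl
      obtain ⟨hy2, hy3⟩ := hy0 le_rfl
      refine ⟨?_, ?_, ?_⟩
      · rw [dotProduct_mulVec, hx3, zero_dotProduct]
        rfl
      all_goals simp [add_vecMul, smul_vecMul, vecMul_vecMul, h.mul_form, hx2, hy2]
    · have hy1 : y.1 = 0 := (mem_annihilated.1 (h3 hy)).1
      obtain ⟨hy2, hy3⟩ := hy0 (by norm_num)
      refine ⟨?_, ?_, ?_⟩
      · rw [hBv _ hy3, dotProduct_zero]
        rfl
      all_goals simp [smul_vecMul, vecMul_vecMul, h.mul_form, hy1, hy2]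
  have hzero : ∀ x y : V 1 n, x ∈ annihilated ⊥ B A → mul J x y = 0 ∧ mul J y x = 0 := by
    intro x y hx
    obtain ⟨hx1, hx2, hx3⟩ := mem_annihilated.1 hx
    have hx1 : x.1 = 0 := hx1
    rw [hmul, hmul, dotProduct_mulVec, hBv _ hx2, hx2, hx3, hx1]
    constructor <;> ext k <;> simp
  have h5 : power J 5 ≤ annihilated ⊥ B A := by
    refine power_succ_succ_le (k := 3) fun i j hij x hx y hy => ?_
    obtain ⟨rfl, rfl⟩ | ⟨rfl, rfl⟩ | ⟨rfl, rfl⟩ | ⟨rfl, rfl⟩ :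
        i = 3 ∧ j = 0 ∨ i = 2 ∧ j = 1 ∨ i = 1 ∧ j = 2 ∨ i = 0 ∧ j = 3 := by omega
    · rw [(hzero x y (h4 hx)).1]
      exact zero_mem _
    · obtain ⟨hx1, hx2, hx3⟩ := mem_annihilated.1 (h3 hx)
      obtain ⟨-, -, hy3⟩ := mem_annihilated.1 (h2 hy)
      have hx1 : x.1 = 0 := hx1
      rw [hmul, mem_annihilated]
      refine ⟨?_, ?_, ?_⟩
      · rw [dotProduct_mulVec, hx2, zero_dotProduct]
        rfl
      all_goals simp [smul_vecMul, vecMul_vecMul, h.mul_form, hx1, hx3]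
    · obtain ⟨hy1, hy2, hy3⟩ := mem_annihilated.1 (h3 hy)
      have hy1 : y.1 = 0 := hy1
      rw [hmul, mem_annihilated]
      refine ⟨?_, ?_, ?_⟩
      · rw [hBv _ hy2, dotProduct_zero]
        rfl
      all_goals simp [smul_vecMul, vecMul_vecMul, h.mul_form, hy1, hy3]
    · rw [(hzero y x (h4 hy)).2]
      exact zero_mem _
  refine ⟨6, by norm_num, le_bot_iff.1 (power_succ_succ_le (k := 4) fun i j hij x hx y hy => ?_)⟩
  rw [Submodule.mem_bot]
  obtain ⟨rfl, rfl⟩ | ⟨rfl, rfl⟩ | ⟨rfl, rfl⟩ | ⟨rfl, rfl⟩ | ⟨rfl, rfl⟩ :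
    i = 4 ∧ j = 0 ∨ i = 3 ∧ j = 1 ∨ i = 2 ∧ j = 2 ∨ i = 1 ∧ j = 3 ∨ i = 0 ∧ j = 4 := by omega
  · exact (hzero x y (h5 hx)).1
  · exact (hzero x y (h4 hx)).1
  · obtain ⟨hx1, hx2, hx3⟩ := mem_annihilated.1 (h3 hx)
    obtain ⟨hy1, hy2, hy3⟩ := mem_annihilated.1 (h3 hy)
    have hx1 : x.1 = 0 := hx1
    have hy1 : y.1 = 0 := hy1
    rw [hmul, hx1, hy1, dotProduct_mulVec, hx2]
    ext k <;> simp
  · exact (hzero y x (h4 hy)).2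
  · exact (hzero y x (h5 hy)).2

/-! ### Type (1,4): pairs of matrices and their orbits. -/

lemma oddMatrix_type14 (A B : Matrix (Fin 4) (Fin 4) ℂ) : oddMatrix (type14 A B) = A := rfl

lemma formMatrix_type14 (A B : Matrix (Fin 4) (Fin 4) ℂ) : formMatrix (type14 A B) = B := rfl

lemma eq_type14 {J : StructureConstants 1 4} (hc : J.c 0 0 0 = 0) :
    J = type14 (oddMatrix J) (formMatrix J) := by
  ext i j k
  · simp [type14, Subsingleton.elim _ (0 : Fin 1), hc]
  · simp [type14, oddMatrix, Subsingleton.elim _ (0 : Fin 1)]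
  · simp [type14, formMatrix, Subsingleton.elim _ (0 : Fin 1)]

/-- The nilpotent Jordan superalgebras with one-dimensional even part, by matrix equations. -/
theorem mem_NJS_iff {n : ℕ} {J : StructureConstants 1 n} :
    J ∈ NJS 1 n ↔ J.c 0 0 0 = 0 ∧ IsNJ (oddMatrix J) (formMatrix J) :=
  ⟨fun h => ⟨h.2.c_eq_zero, IsNJ.of_isJordan h.1 h.2⟩,
    fun h => ⟨h.2.isJordan h.1, h.2.isNilpotentSuper h.1⟩⟩

theorem type14_mem_NJS_iff {A B : Matrix (Fin 4) (Fin 4) ℂ} :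
    type14 A B ∈ NJS 1 4 ↔ IsNJ A B := by
  rw [mem_NJS_iff]
  exact ⟨fun h => h.2, fun h => ⟨rfl, h⟩⟩

lemma act_type14 (g : GL (Fin 1) ℂ × GL (Fin 4) ℂ) (A B : Matrix (Fin 4) (Fin 4) ℂ) :
    act g (type14 A B) =
      type14 ((g.1⁻¹).val 0 0 • ((g.2⁻¹).valᵀ * A * g.2.valᵀ))
        (g.1.val 0 0 • ((g.2⁻¹).valᵀ * B * (g.2⁻¹).val)) := by
  ext i j k
  · simp only [act, mul_eq]
    simp [gradedMap, e, type14, mulVec, dotProduct]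
  · simp only [act, mul_eq]
    obtain rfl : i = 0 := Subsingleton.elim _ _
    simp [gradedMap, e, f, type14, oddMatrix, mulVec, vecMul, dotProduct, Matrix.mul_apply,
      Fin.sum_univ_four]
    left
    ring
  · simp only [act, mul_eq]
    obtain rfl : k = 0 := Subsingleton.elim _ _
    simp [gradedMap, f, type14, formMatrix, mulVec, dotProduct, Matrix.mul_apply,
      Fin.sum_univ_four]
    left
    ring

/-- Here `t` is the scalar acting on the even line and `P` the inverse transpose of the odd change
of basis: the group acts on columns, whereas `A` acts on rows. Stating the first relation as an
intertwining avoids inverses. -/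
lemma mem_orbit_type14_iff {J : StructureConstants 1 4} {A₀ B₀ : Matrix (Fin 4) (Fin 4) ℂ} :
    J ∈ orbit (type14 A₀ B₀) ↔ ∃ A B, J = type14 A B ∧ ∃ t : ℂ, t ≠ 0 ∧
      ∃ P : Matrix (Fin 4) (Fin 4) ℂ, P.det ≠ 0 ∧ t • (A * P) = P * A₀ ∧
        B = t • (P * B₀ * Pᵀ) := by
  constructor
  · rintro ⟨⟨T, S⟩, rfl⟩
    refine ⟨_, _, act_type14 _ _ _, T.val 0 0, ?_, S⁻¹.valᵀ, ?_, ?_, ?_⟩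
    · have := (Matrix.isUnit_iff_isUnit_det _).1 T.isUnit
      simpa using this.ne_zero
    · rw [det_transpose]
      exact ((Matrix.isUnit_iff_isUnit_det _).1 S⁻¹.isUnit).ne_zero
    · have hT : T.val 0 0 ≠ 0 := by
        have := (Matrix.isUnit_iff_isUnit_det _).1 T.isUnit
        simpa using this.ne_zero
      have hS : S.valᵀ * S⁻¹.valᵀ = 1 := by
        rw [← transpose_mul, Units.inv_mul, transpose_one]
      have hT' : T.val 0 0 * T⁻¹.val 0 0 = 1 := by
        have := congrFun (congrFun (Units.mul_inv T) 0) 0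
        rwa [Matrix.mul_apply, Fin.sum_univ_one] at this
      dsimp only
      rw [smul_mul_assoc, smul_smul, hT', one_smul, mul_assoc _ S.valᵀ, hS, mul_one]
    · simp
  · rintro ⟨A, B, rfl, t, ht, P, hP, hA, rfl⟩
    have hPu : IsUnit P.det := hP.isUnit
    have hPt : IsUnit Pᵀ.det := by rwa [det_transpose]
    have htu : IsUnit (t • (1 : Matrix (Fin 1) (Fin 1) ℂ)).det := by simpa using ht
    refine ⟨(GeneralLinearGroup.mk'' _ htu, (GeneralLinearGroup.mk'' Pᵀ hPt)⁻¹), ?_⟩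
    dsimp only
    rw [act_type14]
    have h3 : (GeneralLinearGroup.mk'' Pᵀ hPt).val = Pᵀ := rfl
    have h4 : (GeneralLinearGroup.mk'' _ htu).val = t • (1 : Matrix (Fin 1) (Fin 1) ℂ) := rfl
    have h1 : ((GeneralLinearGroup.mk'' _ htu)⁻¹).val 0 0 = t⁻¹ := by
      rw [coe_units_inv, h4]
      simp
    have h2 : (GeneralLinearGroup.mk'' Pᵀ hPt)⁻¹.val = P⁻¹ᵀ := by
      rw [coe_units_inv, h3, transpose_nonsing_inv]
    rw [h1, inv_inv, h2, h3, h4, transpose_transpose, transpose_transpose,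
      Matrix.smul_apply, one_apply_eq, smul_eq_mul, mul_one, ← hA, smul_mul_assoc,
      mul_nonsing_inv_cancel_right _ _ hPu, smul_smul, inv_mul_cancel₀ ht, one_smul]

lemma type14_injective {A B A' B' : Matrix (Fin 4) (Fin 4) ℂ} (h : type14 A B = type14 A' B') :
    A = A' ∧ B = B' :=
  ⟨congrArg oddMatrix h, congrArg formMatrix h⟩

lemma type14_mem_orbit_iff {A B A₀ B₀ : Matrix (Fin 4) (Fin 4) ℂ} :
    type14 A B ∈ orbit (type14 A₀ B₀) ↔ ∃ t : ℂ, t ≠ 0 ∧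
      ∃ P : Matrix (Fin 4) (Fin 4) ℂ, P.det ≠ 0 ∧ t • (A * P) = P * A₀ ∧
        B = t • (P * B₀ * Pᵀ) := by
  rw [mem_orbit_type14_iff]
  constructor
  · rintro ⟨A', B', h, h'⟩
    obtain ⟨rfl, rfl⟩ := type14_injective h
    exact h'
  · exact fun h => ⟨A, B, rfl, h⟩

lemma type14_mem_orbit_self (A B : Matrix (Fin 4) (Fin 4) ℂ) :
    type14 A B ∈ orbit (type14 A B) :=
  type14_mem_orbit_iff.2 ⟨1, one_ne_zero, 1, by simp, by simp, by simp⟩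

lemma type14_mem_orbit_trans {A B A' B' A₀ B₀ : Matrix (Fin 4) (Fin 4) ℂ}
    (h : type14 A B ∈ orbit (type14 A' B')) (h' : type14 A' B' ∈ orbit (type14 A₀ B₀)) :
    type14 A B ∈ orbit (type14 A₀ B₀) := by
  rw [type14_mem_orbit_iff] at *
  obtain ⟨t, ht, P, hP, h1, rfl⟩ := h
  obtain ⟨s, hs, Q, hQ, h2, rfl⟩ := h'
  refine ⟨t * s, mul_ne_zero ht hs, P * Q, by simp [hP, hQ], ?_, ?_⟩
  · rw [mul_assoc P, ← h2, mul_smul_comm, ← mul_assoc P, ← h1, smul_mul_assoc, smul_smul,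
      mul_comm t, mul_assoc A]
  · simp [mul_assoc, smul_smul]

lemma type14_mem_orbit_symm {A B A' B' : Matrix (Fin 4) (Fin 4) ℂ}
    (h : type14 A B ∈ orbit (type14 A' B')) : type14 A' B' ∈ orbit (type14 A B) := by
  rw [type14_mem_orbit_iff] at *
  obtain ⟨t, ht, P, hP, h1, rfl⟩ := h
  have hPu : IsUnit P.det := hP.isUnit
  have hPt : IsUnit Pᵀ.det := by rwa [det_transpose]
  refine ⟨t⁻¹, inv_ne_zero ht, P⁻¹, by simpa using hP, ?_, ?_⟩
  · calc t⁻¹ • (A' * P⁻¹) = t⁻¹ • (P⁻¹ * (P * A') * P⁻¹) := by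
          rw [nonsing_inv_mul_cancel_left _ _ hPu]
      _ = P⁻¹ * A := by
          rw [← h1, mul_smul_comm, smul_mul_assoc, smul_smul, inv_mul_cancel₀ ht, one_smul,
            ← mul_assoc, mul_nonsing_inv_cancel_right _ _ hPu]
  · rw [mul_smul_comm, smul_mul_assoc, smul_smul, inv_mul_cancel₀ ht, one_smul,
      transpose_nonsing_inv, mul_assoc P, nonsing_inv_mul_cancel_left _ _ hPu,
      mul_nonsing_inv_cancel_right _ _ hPt]

lemma IsNJ.of_mem_orbit {A B A' B' : Matrix (Fin 4) (Fin 4) ℂ} (h' : IsNJ A' B')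
    (h : type14 A B ∈ orbit (type14 A' B')) : IsNJ A B := by
  obtain ⟨t, ht, P, hP, h1, rfl⟩ := type14_mem_orbit_iff.1 h
  have hPu : IsUnit P.det := hP.isUnit
  have hA : A = t⁻¹ • (P * A' * P⁻¹) := by
    rw [← h1, smul_mul_assoc, smul_smul, inv_mul_cancel₀ ht, one_smul,
      mul_nonsing_inv_cancel_right _ _ hPu]
  have hc : ∀ M, P⁻¹ * (P * M) = M := fun M => nonsing_inv_mul_cancel_left _ _ hPu
  have hs := h'.skew
  have hm := h'.mul_form
  subst hA
  refine ⟨?_, ?_, ?_, ?_⟩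
  · simp [mul_assoc, hs]
  · simp only [mul_assoc, smul_mul_assoc, mul_smul_comm, hc]
    simp only [← mul_assoc A', h'.cube]
    simp
  · simp only [mul_assoc, smul_mul_assoc, mul_smul_comm, hc]
    simp [← mul_assoc A', hm]
  · refine h'.square.imp (fun h0 => ?_) (fun h0 => by simp [h0])
    simp only [mul_assoc, smul_mul_assoc, mul_smul_comm, hc]
    simp [← mul_assoc A', h0]

/-! ### Zariski closures and polynomial curves. -/

section Zariski

variable {m n : ℕ}

lemma isClosed_iff {s : Set (StructureConstants m n)} : IsClosed s ↔ s ∈ Set.range zeros := by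
  rw [← isOpen_compl_iff]
  change sᶜᶜ ∈ _ ↔ _
  rw [compl_compl]

lemma isClosed_zeros (I : Ideal (MvPolynomial (Coord m n) ℂ)) : IsClosed (zeros I) :=
  isClosed_iff.2 ⟨I, rfl⟩

lemma mem_closure_iff {s : Set (StructureConstants m n)} {J : StructureConstants m n} :
    J ∈ closure s ↔ ∀ p : MvPolynomial (Coord m n) ℂ,
      (∀ K ∈ s, MvPolynomial.eval K.coords p = 0) → MvPolynomial.eval J.coords p = 0 := by
  constructor
  · intro h p hp
    have hs : s ⊆ zeros (Ideal.span {p}) := fun K hK q hq => by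
      obtain ⟨r, rfl⟩ := Ideal.mem_span_singleton'.1 hq
      rw [map_mul, hp K hK, mul_zero]
    exact closure_minimal hs (isClosed_zeros _) h p (Ideal.mem_span_singleton_self p)
  · intro h
    rw [closure, Set.mem_sInter]
    rintro t ⟨ht, hst⟩
    obtain ⟨I, rfl⟩ := isClosed_iff.1 ht
    exact fun p hp => h p fun K hK => hst hK p hp

/-- The algebra of polynomial functions of the structure constants. -/
noncomputable def polyFun (m n : ℕ) : Subalgebra ℂ (StructureConstants m n → ℂ) :=
  (MvPolynomial.aeval (R := ℂ) fun (i : Coord m n) (J : StructureConstants m n) =>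
    J.coords i).range

lemma isClosed_setOf_polyFun {F : StructureConstants m n → ℂ} (hF : F ∈ polyFun m n) :
    IsClosed {J | F J = 0} := by
  obtain ⟨p, rfl⟩ := hF
  convert isClosed_zeros (Ideal.span {p}) using 1
  have h : ∀ J : StructureConstants m n, MvPolynomial.aeval (R := ℂ)
      (fun (i : Coord m n) (J : StructureConstants m n) => J.coords i) p J =
      MvPolynomial.eval J.coords p := by
    intro J
    induction p using MvPolynomial.induction_on with
    | C a => simp
    | add p q hp hq => simp [hp, hq]
    | mul_X p i hp => simp [hp]
  ext J
  change MvPolynomial.aeval (R := ℂ)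
    (fun (i : Coord m n) (J : StructureConstants m n) => J.coords i) p J = 0 ↔ _
  rw [h]
  constructor
  · intro hp q hq
    obtain ⟨r, rfl⟩ := Ideal.mem_span_singleton'.1 hq
    rw [map_mul, hp, mul_zero]
  · exact fun hJ => hJ p (Ideal.mem_span_singleton_self p)

lemma coords_mem_polyFun (i : Coord m n) :
    (fun J : StructureConstants m n => J.coords i) ∈ polyFun m n :=
  ⟨MvPolynomial.X i, by simp⟩

/-- A polynomial curve in the affine space of structure constants. -/
def IsPolyCurve (J : ℂ → StructureConstants m n) : Prop :=
  ∃ γ : Coord m n → Polynomial ℂ, ∀ s i, (J s).coords i = (γ i).eval s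

lemma IsPolyCurve.exists_eval {J : ℂ → StructureConstants m n} (hJ : IsPolyCurve J)
    (p : MvPolynomial (Coord m n) ℂ) :
    ∃ q : Polynomial ℂ, ∀ s, q.eval s = MvPolynomial.eval (J s).coords p := by
  obtain ⟨γ, hγ⟩ := hJ
  refine ⟨MvPolynomial.aeval γ p, fun s => ?_⟩
  induction p using MvPolynomial.induction_on with
  | C a => simp
  | add p q hp hq => simp [hp, hq]
  | mul_X p i hp => simp [hp, hγ]

lemma Polynomial.exists_eval_ne_zero {q : Polynomial ℂ} (hq : q ≠ 0) : ∃ s, q.eval s ≠ 0 := by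
  by_contra! h
  exact hq (Polynomial.funext fun s => by simp [h s])

/-- A polynomial vanishing on `S` restricts to the curve as some `q` with `D * q` zero everywhere,
so `q = 0`. All degenerations below are produced in this way. -/
lemma IsPolyCurve.mem_closure {J : ℂ → StructureConstants m n} (hJ : IsPolyCurve J)
    {S : Set (StructureConstants m n)} {D : Polynomial ℂ} (hD : D ≠ 0)
    (hS : ∀ s, D.eval s ≠ 0 → J s ∈ S) (s : ℂ) : J s ∈ closure S := by
  rw [mem_closure_iff]
  intro p hp
  obtain ⟨q, hq⟩ := hJ.exists_eval p
  rw [← hq]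
  suffices q = 0 by simp [this]
  by_contra hq0
  obtain ⟨s, hs⟩ := Polynomial.exists_eval_ne_zero (mul_ne_zero hD hq0)
  rw [Polynomial.eval_mul] at hs
  exact (right_ne_zero_of_mul hs) (by rw [hq, hp _ (hS s (left_ne_zero_of_mul hs))])

lemma exists_polynomial_ne_zero_of_isOpen {U : Set (StructureConstants m n)} (hU : IsOpen U)
    {J : StructureConstants m n} (hJ : J ∈ U) : ∃ p : MvPolynomial (Coord m n) ℂ,
      MvPolynomial.eval J.coords p ≠ 0 ∧ ∀ K, MvPolynomial.eval K.coords p ≠ 0 → K ∈ U := by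
  obtain ⟨I, hI⟩ := isClosed_iff.1 hU.isClosed_compl
  have h : J ∉ zeros I := fun h => by
    rw [hI] at h
    exact h hJ
  simp only [zeros, Set.mem_ofPred_eq, not_forall] at h
  obtain ⟨p, hp, hJp⟩ := h
  refine ⟨p, hJp, fun K hK => ?_⟩
  by_contra hKU
  have : K ∈ zeros I := by
    rw [hI]
    exact hKU
  exact hK (this p hp)

/-- A set is irreducible if any two of its points are joined by a polynomial curve which
generically lies in the set. -/
lemma isPreirreducible_of_curves {S : Set (StructureConstants m n)}
    (h : ∀ J₁ ∈ S, ∀ J₂ ∈ S, ∃ J : ℂ → StructureConstants m n, IsPolyCurve J ∧ J 0 = J₁ ∧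
      J 1 = J₂ ∧ ∃ D : Polynomial ℂ, D ≠ 0 ∧ ∀ s, D.eval s ≠ 0 → J s ∈ S) :
    IsPreirreducible S := by
  rintro U W hU hW ⟨J₁, h1, hJ1⟩ ⟨J₂, h2, hJ2⟩
  obtain ⟨p, hp, hpU⟩ := exists_polynomial_ne_zero_of_isOpen hU hJ1
  obtain ⟨q, hq, hqW⟩ := exists_polynomial_ne_zero_of_isOpen hW hJ2
  obtain ⟨J, hJ, rfl, rfl, D, hD, hS⟩ := h J₁ h1 J₂ h2
  obtain ⟨p', hp'⟩ := hJ.exists_eval p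
  obtain ⟨q', hq'⟩ := hJ.exists_eval q
  have hp0 : p' ≠ 0 := by
    rintro rfl
    exact hp (by simp [← hp'])
  have hq0 : q' ≠ 0 := by
    rintro rfl
    exact hq (by simp [← hq'])
  -- A parameter outside the finitely many zeros of all three polynomials gives a point of `S` in
  -- both open sets.
  obtain ⟨s, hs⟩ := Polynomial.exists_eval_ne_zero (mul_ne_zero hD (mul_ne_zero hp0 hq0))
  rw [Polynomial.eval_mul, Polynomial.eval_mul, hp', hq'] at hs
  exact ⟨J s, hS s (left_ne_zero_of_mul hs),
    hpU _ (left_ne_zero_of_mul (right_ne_zero_of_mul hs)),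
    hqW _ (right_ne_zero_of_mul (right_ne_zero_of_mul hs))⟩

end Zariski

/-! ### Irreducibility of orbits. -/

/-- The value at `s` of a polynomial matrix. -/
noncomputable def evalMatrix (s : ℂ) :
    Matrix (Fin 4) (Fin 4) (Polynomial ℂ) →+* Matrix (Fin 4) (Fin 4) ℂ :=
  (Polynomial.evalRingHom s).mapMatrix

lemma isPolyCurve_type14 (A B : Matrix (Fin 4) (Fin 4) (Polynomial ℂ)) :
    IsPolyCurve fun s => type14 (evalMatrix s A) (evalMatrix s B) := by
  refine ⟨fun
    | .inl _ => 0
    | .inr (.inl (_, j, k)) => A j k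
    | .inr (.inr (i, j, _)) => B i j, ?_⟩
  rintro s (_ | _ | _) <;> simp [StructureConstants.coords, type14, evalMatrix]

lemma evalMatrix_apply (s : ℂ) (A : Matrix (Fin 4) (Fin 4) (Polynomial ℂ)) (i j : Fin 4) :
    evalMatrix s A i j = (A i j).eval s := rfl

lemma eval_det (s : ℂ) (A : Matrix (Fin 4) (Fin 4) (Polynomial ℂ)) :
    A.det.eval s = (evalMatrix s A).det :=
  RingHom.map_det (Polynomial.evalRingHom s) A

lemma evalMatrix_adjugate (s : ℂ) (A : Matrix (Fin 4) (Fin 4) (Polynomial ℂ)) :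
    evalMatrix s A.adjugate = (evalMatrix s A).adjugate :=
  RingHom.map_adjugate (Polynomial.evalRingHom s) A

lemma evalMatrix_transpose (s : ℂ) (A : Matrix (Fin 4) (Fin 4) (Polynomial ℂ)) :
    evalMatrix s Aᵀ = (evalMatrix s A)ᵀ := rfl

lemma evalMatrix_smul (s : ℂ) (a : Polynomial ℂ) (A : Matrix (Fin 4) (Fin 4) (Polynomial ℂ)) :
    evalMatrix s (a • A) = a.eval s • evalMatrix s A := by
  ext i j
  simp [evalMatrix_apply]

lemma evalMatrix_map_C (s : ℂ) (A : Matrix (Fin 4) (Fin 4) ℂ) :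
    evalMatrix s (A.map Polynomial.C) = A := by
  ext i j
  simp [evalMatrix_apply]

/-- Rescaling both products yields an isomorphic superalgebra. -/
def HasScaling (A₀ B₀ : Matrix (Fin 4) (Fin 4) ℂ) : Prop :=
  ∀ a b : ℂ, a ≠ 0 → b ≠ 0 → type14 (a • A₀) (b • B₀) ∈ orbit (type14 A₀ B₀)

lemma HasScaling.of_diagonal {A₀ B₀ : Matrix (Fin 4) (Fin 4) ℂ}
    (h : ∀ a b : ℂ, a ≠ 0 → b ≠ 0 → ∃ q : Fin 4 → ℂ, (∀ i, q i ≠ 0) ∧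
      (∀ i j, a * A₀ i j * q j = q i * A₀ i j) ∧ ∀ i j, b * B₀ i j = q i * B₀ i j * q j) :
    HasScaling A₀ B₀ := by
  intro a b ha hb
  obtain ⟨q, hq, h1, h2⟩ := h a b ha hb
  refine type14_mem_orbit_iff.2 ⟨1, one_ne_zero, diagonal q, ?_, ?_, ?_⟩
  · rw [det_diagonal]
    exact Finset.prod_ne_zero_iff.2 fun i _ => hq i
  · ext i j
    simp [h1, ← mul_assoc]
  · ext i j
    simp [h2]

/-- Replacing `P⁻¹` by the adjugate makes the parametrization polynomial in `(a, b, P)`. The extra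
factor `det P` is absorbed by the free rescaling of `A₀`. -/
lemma HasScaling.param_mem_orbit {A₀ B₀ : Matrix (Fin 4) (Fin 4) ℂ} (h : HasScaling A₀ B₀)
    {a b : ℂ} (ha : a ≠ 0) (hb : b ≠ 0) {P : Matrix (Fin 4) (Fin 4) ℂ} (hP : P.det ≠ 0) :
    type14 (a • (P * A₀ * P.adjugate)) (b • (P * B₀ * Pᵀ)) ∈ orbit (type14 A₀ B₀) := by
  refine type14_mem_orbit_trans ?_ (h (a * P.det) b (mul_ne_zero ha hP) hb)
  refine type14_mem_orbit_iff.2 ⟨1, one_ne_zero, P, hP, ?_, ?_⟩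
  · simp [mul_assoc, adjugate_mul, smul_smul]
  · simp

lemma exists_param_of_mem_orbit {J : StructureConstants 1 4} {A₀ B₀ : Matrix (Fin 4) (Fin 4) ℂ}
    (h : J ∈ orbit (type14 A₀ B₀)) : ∃ a b : ℂ, a ≠ 0 ∧ b ≠ 0 ∧
      ∃ P : Matrix (Fin 4) (Fin 4) ℂ, P.det ≠ 0 ∧
        J = type14 (a • (P * A₀ * P.adjugate)) (b • (P * B₀ * Pᵀ)) := by
  obtain ⟨A, B, rfl, t, ht, P, hP, hA, rfl⟩ := mem_orbit_type14_iff.1 h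
  refine ⟨t⁻¹ * P.det⁻¹, t, mul_ne_zero (inv_ne_zero ht) (inv_ne_zero hP), ht, P, hP, ?_⟩
  congr 1
  rw [← hA, smul_mul_assoc, mul_assoc, mul_adjugate, mul_smul_comm, mul_one, smul_smul, smul_smul]
  field_simp
  simp

/-- Two points are joined by the segment between their parameters `(a, b, P)`; the curve stays in
the orbit wherever `a`, `b` and `det P` are all nonzero. -/
theorem HasScaling.isIrreducible_orbit {A₀ B₀ : Matrix (Fin 4) (Fin 4) ℂ}
    (h : HasScaling A₀ B₀) : IsIrreducible (orbit (type14 A₀ B₀)) := by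
  refine ⟨⟨_, type14_mem_orbit_self _ _⟩, isPreirreducible_of_curves ?_⟩
  intro J₁ h1 J₂ h2
  obtain ⟨a₁, b₁, ha₁, hb₁, P₁, hP₁, rfl⟩ := exists_param_of_mem_orbit h1
  obtain ⟨a₂, b₂, ha₂, hb₂, P₂, hP₂, rfl⟩ := exists_param_of_mem_orbit h2
  let line (x y : ℂ) : Polynomial ℂ := (1 - Polynomial.X) * Polynomial.C x +
    Polynomial.X * Polynomial.C y
  have hline0 : ∀ x y, (line x y).eval 0 = x := fun x y => by simp [line]
  have hline1 : ∀ x y, (line x y).eval 1 = y := fun x y => by simp [line]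
  let P : Matrix (Fin 4) (Fin 4) (Polynomial ℂ) := Matrix.of fun i j => line (P₁ i j) (P₂ i j)
  have hP0 : evalMatrix 0 P = P₁ := by
    ext i j
    exact hline0 _ _
  have hP1 : evalMatrix 1 P = P₂ := by
    ext i j
    exact hline1 _ _
  have hs : ∀ s, type14
      (evalMatrix s (line a₁ a₂ • (P * A₀.map Polynomial.C * P.adjugate)))
      (evalMatrix s (line b₁ b₂ • (P * B₀.map Polynomial.C * Pᵀ))) =
      type14 ((line a₁ a₂).eval s • (evalMatrix s P * A₀ * (evalMatrix s P).adjugate))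
        ((line b₁ b₂).eval s • (evalMatrix s P * B₀ * (evalMatrix s P)ᵀ)) := fun s => by
    simp only [evalMatrix_smul, map_mul, evalMatrix_map_C, evalMatrix_adjugate,
      evalMatrix_transpose]
  refine ⟨_, isPolyCurve_type14 (line a₁ a₂ • (P * A₀.map Polynomial.C * P.adjugate))
    (line b₁ b₂ • (P * B₀.map Polynomial.C * Pᵀ)), ?_, ?_,
    line a₁ a₂ * line b₁ b₂ * P.det, ?_, fun s hD => ?_⟩
  · simp only [hs, hP0, hline0]
  · simp only [hs, hP1, hline1]
  · have key : ∀ q : Polynomial ℂ, q.eval 0 ≠ 0 → q ≠ 0 := by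
      rintro q hq rfl
      simp at hq
    refine key _ ?_
    simp [hline0, eval_det, hP0, ha₁, hb₁, hP₁]
  · simp only [Polynomial.eval_mul, eval_det, mul_ne_zero_iff] at hD
    rw [hs]
    exact h.param_mem_orbit hD.1.1 hD.1.2 hD.2

/-- In this lemma and the next three, the diagonal weights solve `a q_j = q_i` for each nonzero
entry `(i, j)` of `A₀` and `q_i q_j = b` for each nonzero entry of `B₀`. -/
lemma hasScaling_3 : HasScaling 0 (skew 0 1 + skew 2 3) := .of_diagonal fun _ b _ hb =>
  ⟨![b, 1, b, 1], by simp [Fin.forall_fin_succ, hb], by simp,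
    by simp [Fin.forall_fin_succ, skew, Matrix.single]⟩

lemma hasScaling_6 : HasScaling (Matrix.single 1 0 1) (skew 2 3) := .of_diagonal fun a b ha hb =>
  ⟨![1, a, b, 1], by simp [Fin.forall_fin_succ, ha, hb],
    by simp [Fin.forall_fin_succ, Matrix.single],
    by simp [Fin.forall_fin_succ, skew, Matrix.single]⟩

lemma hasScaling_7 : HasScaling (Matrix.single 1 0 1 + Matrix.single 2 1 1) 0 :=
  .of_diagonal fun a b ha _ =>
  ⟨![1, a, a * a, 1], by simp [Fin.forall_fin_succ, ha],
    by simp [Fin.forall_fin_succ, Matrix.single], by simp⟩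

lemma hasScaling_9 : HasScaling (Matrix.single 1 0 1 + Matrix.single 3 2 1) (skew 1 3) :=
  .of_diagonal fun a b ha hb =>
  ⟨![b / a, b, 1 / a, 1], by simp [Fin.forall_fin_succ, ha, hb],
    by simp [Fin.forall_fin_succ, Matrix.single, ha, mul_div_cancel₀],
    by simp [Fin.forall_fin_succ, skew, Matrix.single]⟩

/-! ### Normal forms and degenerations. -/

/-- The rows of `Q` are the new odd basis vectors in old coordinates. In the proofs below, finding
the orbit of an algebra means choosing these rows. -/
lemma type14_mem_orbit_of_basis {A B A₀ B₀ Q : Matrix (Fin 4) (Fin 4) ℂ} (hQ : Q.det ≠ 0)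
    (hA : Q * A = A₀ * Q) (hB : Q * B * Qᵀ = B₀) : type14 A B ∈ orbit (type14 A₀ B₀) :=
  type14_mem_orbit_symm (type14_mem_orbit_iff.2 ⟨1, one_ne_zero, Q, hQ, by simp [hA], by simp [hB]⟩)

lemma det_ne_zero_of_linearIndependent {Q : Matrix (Fin 4) (Fin 4) ℂ}
    (hQ : LinearIndependent ℂ Q.row) : Q.det ≠ 0 :=
  ((Matrix.isUnit_iff_isUnit_det _).1 (linearIndependent_rows_iff_isUnit.1 hQ)).ne_zero

lemma form_skew {B : Matrix (Fin 4) (Fin 4) ℂ} (hB : Bᵀ = -B) (u v : Fin 4 → ℂ) :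
    u ⬝ᵥ B *ᵥ v = -(v ⬝ᵥ B *ᵥ u) := by
  rw [← vecMul_transpose, hB, vecMul_neg, dotProduct_neg, dotProduct_comm, ← dotProduct_mulVec]

/-- Normal form of nonzero alternating forms on `ℂ⁴`. -/
lemma exists_skew_normal_form {B : Matrix (Fin 4) (Fin 4) ℂ} (hB : Bᵀ = -B) (hB0 : B ≠ 0) :
    ∃ Q : Matrix (Fin 4) (Fin 4) ℂ, Q.det ≠ 0 ∧ ∃ l : ℂ,
      Q * B * Qᵀ = l • skew 0 1 + skew 2 3 := by
  have hsk := form_skew hB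
  have hself : ∀ u, u ⬝ᵥ B *ᵥ u = 0 := fun u => self_eq_neg.1 (hsk u u)
  obtain ⟨x, y, hxy⟩ : ∃ x y, x ⬝ᵥ B *ᵥ y = 1 := by
    obtain ⟨i, j, hij⟩ : ∃ i j, B i j ≠ 0 := by
      by_contra! h0
      exact hB0 (by ext i j; exact h0 i j)
    exact ⟨Pi.single i 1, (B i j)⁻¹ • Pi.single j 1, by simp [mulVec_smul, hij]⟩
  have hyx : y ⬝ᵥ B *ᵥ x = -1 := by rw [hsk, hxy]
  -- The kernel of `M` is the orthogonal complement of the hyperbolic pair `x, y`, of dimension at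
  -- least 2. The scalar `l` will be the value of the form on two independent vectors `z, r` there,
  -- and may be zero.
  let M : Matrix (Fin 2) (Fin 4) ℂ := Matrix.of ![x ᵥ* B, y ᵥ* B]
  have hW : 1 < Module.finrank ℂ (LinearMap.ker M.mulVecLin) := by
    have h1 := LinearMap.finrank_range_add_finrank_ker M.mulVecLin
    have h2 := Submodule.finrank_le (LinearMap.range M.mulVecLin)
    simp only [Module.finrank_fintype_fun_eq_card, Fintype.card_fin] at h1 h2
    omega
  have hker : ∀ w ∈ LinearMap.ker M.mulVecLin, x ⬝ᵥ B *ᵥ w = 0 ∧ y ⬝ᵥ B *ᵥ w = 0 := by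
    intro w hw
    rw [LinearMap.mem_ker, mulVecLin_apply] at hw
    have h0 := congrFun hw 0
    have h1 := congrFun hw 1
    rw [dotProduct_mulVec, dotProduct_mulVec]
    exact ⟨h0, h1⟩
  obtain ⟨⟨z, hzW⟩, hz⟩ : ∃ z : LinearMap.ker M.mulVecLin, z ≠ 0 := by
    have : Nontrivial (LinearMap.ker M.mulVecLin) :=
      Module.nontrivial_of_finrank_pos (R := ℂ) (by omega)
    exact exists_ne 0
  obtain ⟨⟨r, hrW⟩, hr⟩ := exists_linearIndependent_pair_of_one_lt_finrank hW hz
  obtain ⟨hxz, hyz⟩ := hker z hzW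
  obtain ⟨hxr, hyr⟩ := hker r hrW
  have hzr : ∀ a b : ℂ, a • z + b • r = 0 → a = 0 ∧ b = 0 := by
    intro a b hab
    exact LinearIndependent.pair_iff.1 hr a b (Subtype.ext hab)
  have hzx : z ⬝ᵥ B *ᵥ x = 0 := by rw [hsk, hxz, neg_zero]
  have hzy : z ⬝ᵥ B *ᵥ y = 0 := by rw [hsk, hyz, neg_zero]
  have hrx : r ⬝ᵥ B *ᵥ x = 0 := by rw [hsk, hxr, neg_zero]
  have hry : r ⬝ᵥ B *ᵥ y = 0 := by rw [hsk, hyr, neg_zero]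
  have hrz : r ⬝ᵥ B *ᵥ z = -(z ⬝ᵥ B *ᵥ r) := hsk _ _
  refine ⟨Matrix.of ![z, r, x, y], det_ne_zero_of_linearIndependent ?_, z ⬝ᵥ B *ᵥ r, ?_⟩
  · rw [Fintype.linearIndependent_iff]
    intro g hg
    have hg : g 0 • z + g 1 • r + g 2 • x + g 3 • y = 0 := by
      rw [← hg, Fin.sum_univ_four]
      rfl
    have h2 : g 2 = 0 := by
      have := congrArg (fun w => w ⬝ᵥ B *ᵥ y) hg
      simpa [add_dotProduct, smul_dotProduct, hzy, hry, hxy, hself] using this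
    have h3 : g 3 = 0 := by
      have := congrArg (fun w => w ⬝ᵥ B *ᵥ x) hg
      simpa [add_dotProduct, smul_dotProduct, hzx, hrx, hyx, hself] using this
    rw [h2, h3, zero_smul, zero_smul, add_zero, add_zero] at hg
    obtain ⟨h0, h1⟩ := hzr _ _ hg
    intro i
    fin_cases i <;> assumption
  · have hQ : ∀ i j, (Matrix.of ![z, r, x, y] * B * (Matrix.of ![z, r, x, y])ᵀ) i j =
        ![z, r, x, y] i ⬝ᵥ B *ᵥ ![z, r, x, y] j := fun i j => by
      rw [dotProduct_mulVec]
      rfl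
    ext i j
    rw [hQ]
    fin_cases i <;> fin_cases j <;>
      simp [skew, Matrix.single, hself, hxy, hyx, hxz, hyz, hxr, hyr, hzx, hzy, hrx, hry, hrz]

theorem mem_orbit_14_3_of_det_ne_zero {A B : Matrix (Fin 4) (Fin 4) ℂ} (h : IsNJ A B)
    (hB : B.det ≠ 0) : type14 A B ∈ orbit J14_3 := by
  have hA : A = 0 := by
    have := congrArg (· * B⁻¹) h.mul_form
    simpa [mul_nonsing_inv_cancel_right _ _ hB.isUnit] using this
  subst hA
  have hB0 : B ≠ 0 := by
    rintro rfl
    simp at hB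
  obtain ⟨Q, hQ, l, hQB⟩ := exists_skew_normal_form h.skew hB0
  have hl : l ≠ 0 := by
    rintro rfl
    have := congrArg det hQB
    rw [det_mul, det_mul, det_transpose] at this
    have h0 : (skew 2 3 : Matrix (Fin 4) (Fin 4) ℂ).det = 0 :=
      det_eq_zero_of_row_eq_zero 0 (by simp [skew, Matrix.single])
    rw [zero_smul, zero_add, h0] at this
    simp [hQ, hB] at this
  refine type14_mem_orbit_trans
    (type14_mem_orbit_of_basis (A₀ := 0) (B₀ := l • skew 0 1 + skew 2 3) hQ (by simp) hQB) ?_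
  refine type14_mem_orbit_of_basis (Q := diagonal ![l⁻¹, 1, 1, 1]) ?_ (by simp) ?_
  · simp [det_diagonal, Fin.prod_univ_four, hl]
  · ext i j
    fin_cases i <;> fin_cases j <;> simp [skew, Matrix.single, hl]

lemma skew_two_three : skew 2 3 = !![0, 0, 0, 0; 0, 0, 0, 0; 0, 0, 0, 1; 0, 0, -1, 0] := by
  ext i j
  fin_cases i <;> fin_cases j <;> simp [skew, Matrix.single]

lemma skew_one_three : skew 1 3 = !![0, 0, 0, 0; 0, 0, 0, 1; 0, 0, 0, 0; 0, -1, 0, 0] := by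
  ext i j
  fin_cases i <;> fin_cases j <;> simp [skew, Matrix.single]

lemma oddMatrix_14_6 : Matrix.single 1 0 1 =
    (!![0, 0, 0, 0; 1, 0, 0, 0; 0, 0, 0, 0; 0, 0, 0, 0] : Matrix (Fin 4) (Fin 4) ℂ) := by
  ext i j
  fin_cases i <;> fin_cases j <;> simp [Matrix.single]

lemma oddMatrix_14_7 : Matrix.single 1 0 1 + Matrix.single 2 1 1 =
    (!![0, 0, 0, 0; 1, 0, 0, 0; 0, 1, 0, 0; 0, 0, 0, 0] : Matrix (Fin 4) (Fin 4) ℂ) := by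
  ext i j
  fin_cases i <;> fin_cases j <;> simp [Matrix.single]

lemma oddMatrix_14_9 : Matrix.single 1 0 1 + Matrix.single 3 2 1 =
    (!![0, 0, 0, 0; 1, 0, 0, 0; 0, 0, 0, 0; 0, 0, 1, 0] : Matrix (Fin 4) (Fin 4) ℂ) := by
  ext i j
  fin_cases i <;> fin_cases j <;> simp [Matrix.single]

/-- The matrix whose only nonzero block is the lower left one. -/
def lowerLeft (p q p' q' : ℂ) : Matrix (Fin 4) (Fin 4) ℂ :=
  !![0, 0, 0, 0; 0, 0, 0, 0; p, q, 0, 0; p', q', 0, 0]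

/-- The new basis, with indices from 0, is `e_1 f_2, f_2, e_1 f_3, f_3`; it is independent because
the block is invertible. -/
lemma lowerLeft_mem_orbit_14_9 {p q p' q' : ℂ} (h : p * q' - q * p' ≠ 0) :
    type14 (lowerLeft p q p' q') (skew 2 3) ∈ orbit J14_9 := by
  refine type14_mem_orbit_of_basis
    (Q := !![p, q, 0, 0; 0, 0, 1, 0; p', q', 0, 0; 0, 0, 0, 1]) ?_ ?_ ?_
  · simp [det_succ_row_zero, Fin.sum_univ_succ, Fin.succAbove]
    contrapose! h
    linear_combination -h
  · rw [oddMatrix_14_9, lowerLeft]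
    ext i j
    fin_cases i <;> fin_cases j <;> simp [Matrix.mul_apply, Fin.sum_univ_four]
  · rw [skew_two_three, skew_one_three]
    ext i j
    fin_cases i <;> fin_cases j <;> simp [Matrix.mul_apply, Fin.sum_univ_four]

/-- Invertible 2 × 2 blocks are dense: the segment from the given block to the identity has
generically nonzero determinant. -/
lemma lowerLeft_mem_closure (p q p' q' : ℂ) :
    type14 (lowerLeft p q p' q') (skew 2 3) ∈ closure (orbit J14_9) := by
  let N : Matrix (Fin 4) (Fin 4) (Polynomial ℂ) :=
    (1 - Polynomial.X : Polynomial ℂ) • (lowerLeft p q p' q').map Polynomial.C +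
      (Polynomial.X : Polynomial ℂ) • (lowerLeft 1 0 0 1).map Polynomial.C
  let C : Matrix (Fin 4) (Fin 4) (Polynomial ℂ) := (skew 2 3).map Polynomial.C
  have hN : ∀ s, evalMatrix s N =
      lowerLeft ((1 - s) * p + s) ((1 - s) * q) ((1 - s) * p') ((1 - s) * q' + s) := by
    intro s
    simp only [N, map_add, evalMatrix_smul, evalMatrix_map_C]
    ext i j
    fin_cases i <;> fin_cases j <;> simp [lowerLeft]
  have h := (isPolyCurve_type14 N C).mem_closure (S := orbit J14_9)
    (D := N 2 0 * N 3 1 - N 2 1 * N 3 0) (by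
      intro h0
      have := congrArg (Polynomial.eval 1) h0
      simp [N, lowerLeft] at this) (fun s hs => by
      simp only [Polynomial.eval_sub, Polynomial.eval_mul, ← evalMatrix_apply] at hs
      rw [evalMatrix_map_C]
      rw [hN] at hs ⊢
      exact lowerLeft_mem_orbit_14_9 hs) 0
  simpa [hN, C, evalMatrix_map_C] using h

/-- By `AB = 0` the image of `A` lies in the radical `⟨f_0, f_1⟩` of the form. Write `N` for the
upper left block and `L` for the lower left one; `A² = 0` means `N² = 0` and `LN = 0`. If `N ≠ 0`,
the rows of `L` are multiples of the single direction spanned by the rows of `N`, so `L` is cleared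
by adding to `f_2, f_3` multiples of a radical vector not killed by `N`. -/
lemma mem_orbit_14_6_or_eq_lowerLeft {A : Matrix (Fin 4) (Fin 4) ℂ} (h : IsNJ A (skew 2 3)) :
    type14 A (skew 2 3) ∈ orbit J14_6 ∨ ∃ p q p' q', A = lowerLeft p q p' q' := by
  have hsq : A * A = 0 := h.square.resolve_right fun h0 => by
    simpa [skew, Matrix.single] using congrFun (congrFun h0 2) 3
  have h2 : ∀ i, A i 2 = 0 := fun i => by
    have := congrFun (congrFun h.mul_form i) 3
    rw [skew_two_three] at this
    simpa [Matrix.mul_apply, Fin.sum_univ_four] using this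
  have h3 : ∀ i, A i 3 = 0 := fun i => by
    have := congrFun (congrFun h.mul_form i) 2
    rw [skew_two_three] at this
    simpa [Matrix.mul_apply, Fin.sum_univ_four] using this
  obtain ⟨a, b, c, d, p, q, p', q', rfl⟩ : ∃ a b c d p q p' q',
      A = !![a, b, 0, 0; c, d, 0, 0; p, q, 0, 0; p', q', 0, 0] := by
    refine ⟨A 0 0, A 0 1, A 1 0, A 1 1, A 2 0, A 2 1, A 3 0, A 3 1, ?_⟩
    ext i j
    fin_cases i <;> fin_cases j <;> simp [h2, h3]
  have hentry := fun i j => congrFun (congrFun hsq i) j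
  have e00 := hentry 0 0
  have e01 := hentry 0 1
  have e10 := hentry 1 0
  have e11 := hentry 1 1
  have e20 := hentry 2 0
  have e21 := hentry 2 1
  have e30 := hentry 3 0
  have e31 := hentry 3 1
  simp [Matrix.mul_apply, Fin.sum_univ_four] at e00 e01 e10 e11 e20 e21 e30 e31
  by_cases hb : b = 0
  · subst hb
    obtain rfl : a = 0 := by simpa using e00
    obtain rfl : d = 0 := by simpa using e11
    by_cases hc : c = 0
    · subst hc
      exact Or.inr ⟨p, q, p', q', rfl⟩
    · left
      have hq : q = 0 := by simpa [hc] using e20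
      have hq' : q' = 0 := by simpa [hc] using e30
      subst hq hq'
      refine type14_mem_orbit_of_basis
        (Q := !![c, 0, 0, 0; 0, 1, 0, 0; 0, -(p / c), 1, 0; 0, -(p' / c), 0, 1]) ?_ ?_ ?_
      · simp [det_succ_row_zero, Fin.sum_univ_succ, Fin.succAbove, hc]
      · rw [oddMatrix_14_6]
        ext i j
        fin_cases i <;> fin_cases j <;> simp [Matrix.mul_apply, Fin.sum_univ_four, hc]
      · rw [skew_two_three]
        ext i j
        fin_cases i <;> fin_cases j <;> simp [Matrix.mul_apply, Fin.sum_univ_four]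
  · left
    have had : d = -a := by
      have : b * (a + d) = 0 := by linear_combination e01
      rcases mul_eq_zero.1 this with h0 | h0
      · exact absurd h0 hb
      · linear_combination h0
    subst had
    have hp : p - q / b * a = 0 := by
      field_simp
      linear_combination e21
    have hp' : p' - q' / b * a = 0 := by
      field_simp
      linear_combination e31
    refine type14_mem_orbit_of_basis
      (Q := !![a, b, 0, 0; 1, 0, 0, 0; -(q / b), 0, 1, 0; -(q' / b), 0, 0, 1]) ?_ ?_ ?_
    · simp [det_succ_row_zero, Fin.sum_univ_succ, Fin.succAbove, hb]
    · rw [oddMatrix_14_6]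
      ext i j
      fin_cases i <;> fin_cases j <;> simp [Matrix.mul_apply, Fin.sum_univ_four, hb, e00] <;>
        first | ring1 | linear_combination hp | linear_combination hp'
    · rw [skew_two_three]
      ext i j
      fin_cases i <;> fin_cases j <;> simp [Matrix.mul_apply, Fin.sum_univ_four]

/-- A superalgebra with nonzero products `V₀V₁` and `V₁V₁` is isomorphic to one with `V₁V₁` in
normal form. -/
lemma exists_normal_form {A B : Matrix (Fin 4) (Fin 4) ℂ} (h : IsNJ A B) (hA : A ≠ 0)
    (hB : B ≠ 0) : ∃ A', type14 A B ∈ orbit (type14 A' (skew 2 3)) ∧ IsNJ A' (skew 2 3) := by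
  obtain ⟨Q, hQ, l, hQB⟩ := exists_skew_normal_form h.skew hB
  -- For `l ≠ 0` the form would be nondegenerate, and `AB = 0` would give `A = 0`.
  have hl : l = 0 := by
    by_contra hl
    have hdet : B.det = 0 := by
      by_contra hdet
      apply hA
      have := congrArg (· * B⁻¹) h.mul_form
      simpa [mul_nonsing_inv_cancel_right _ _ (Ne.isUnit hdet)] using this
    have := congrArg det hQB
    rw [det_mul, det_mul, hdet, mul_zero, zero_mul] at this
    have h1 : l • skew 0 1 + skew 2 3 = !![0, l, 0, 0; -l, 0, 0, 0; 0, 0, 0, 1; 0, 0, -1, 0] := by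
      ext i j
      fin_cases i <;> fin_cases j <;> simp [skew, Matrix.single]
    rw [h1] at this
    simp [det_succ_row_zero, Fin.sum_univ_succ, Fin.succAbove, hl] at this
  rw [hl, zero_smul, zero_add] at hQB
  have ho : type14 A B ∈ orbit (type14 (Q * A * Q⁻¹) (skew 2 3)) :=
    type14_mem_orbit_of_basis hQ
      (by rw [mul_assoc _ Q⁻¹, nonsing_inv_mul _ hQ.isUnit, mul_one]) hQB
  exact ⟨_, ho, h.of_mem_orbit (type14_mem_orbit_symm ho)⟩

theorem mem_orbit_14_7_of_square_ne_zero {A B : Matrix (Fin 4) (Fin 4) ℂ} (h : IsNJ A B)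
    (hA : A * A ≠ 0) : type14 A B ∈ orbit J14_7 := by
  obtain rfl : B = 0 := h.square.resolve_left hA
  obtain ⟨v, hv⟩ : ∃ v, v ᵥ* A ᵥ* A ≠ 0 := by
    by_contra! hv
    apply hA
    ext i j
    have := congrFun (hv (Pi.single i 1)) j
    rw [vecMul_vecMul, single_one_vecMul] at this
    exact this
  have hv3 : v ᵥ* A ᵥ* A ᵥ* A = 0 := by simp [vecMul_vecMul, h.cube]
  have hind : LinearIndependent ℂ ![v ᵥ* A ᵥ* A, v ᵥ* A, v] := by
    rw [Fintype.linearIndependent_iff]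
    intro g hg
    have hg : g 0 • (v ᵥ* A ᵥ* A) + g 1 • (v ᵥ* A) + g 2 • v = 0 := by
      rw [← hg, Fin.sum_univ_three]
      rfl
    have h2 : g 2 = 0 := by
      have := congrArg (fun w => w ᵥ* A ᵥ* A) hg
      simpa [add_vecMul, smul_vecMul, hv3, hv, -vecMul_vecMul] using this
    rw [h2, zero_smul, add_zero] at hg
    have h1 : g 1 = 0 := by
      have := congrArg (fun w => w ᵥ* A) hg
      simpa [add_vecMul, smul_vecMul, hv3, hv, -vecMul_vecMul] using this
    rw [h1, zero_smul, add_zero] at hg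
    have h0 : g 0 = 0 := by simpa [hv, -vecMul_vecMul] using hg
    intro i
    fin_cases i <;> assumption
  -- A nilpotent matrix of index 3 in dimension 4 has Jordan type (3,1): the chain from `v` is
  -- completed by `w`, which is corrected below.
  obtain ⟨w, hw⟩ := exists_linearIndependent_cons_of_lt_finrank hind (by simp)
  set Q : Matrix (Fin 4) (Fin 4) ℂ := Matrix.of ![w, v ᵥ* A ᵥ* A, v ᵥ* A, v] with hQdef
  have hQ : Q.det ≠ 0 := det_ne_zero_of_linearIndependent hw
  set A' := Q * A * Q⁻¹ with hA'
  have hQA : Q * A = A' * Q := by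
    rw [hA', mul_assoc _ Q⁻¹, nonsing_inv_mul _ hQ.isUnit, mul_one]
  have ho : type14 A 0 ∈ orbit (type14 A' 0) := type14_mem_orbit_of_basis hQ hQA (by simp)
  have h' : IsNJ A' 0 := h.of_mem_orbit (type14_mem_orbit_symm ho)
  have hrow : ∀ i (u : Fin 4 → ℂ), Q i ᵥ* A = u ᵥ* Q → A' i = u := fun i u hu => by
    have h1 : Q i ᵥ* A = (Q * A) i := rfl
    rw [h1, hQA] at hu
    have h2 : A' i ᵥ* Q = u ᵥ* Q := hu
    have := congrArg (· ᵥ* Q⁻¹) h2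
    simpa [vecMul_vecMul, mul_nonsing_inv _ hQ.isUnit] using this
  have hr1 : A' 1 = 0 := hrow 1 0 (by rw [zero_vecMul]; exact hv3)
  have hr2 : A' 2 = Pi.single 1 1 := hrow 2 _ (by rw [single_one_vecMul]; rfl)
  have hr3 : A' 3 = Pi.single 2 1 := hrow 3 _ (by rw [single_one_vecMul]; rfl)
  obtain ⟨d, a, b, c, hAeq⟩ : ∃ d a b c,
      A' = !![d, a, b, c; 0, 0, 0, 0; 0, 1, 0, 0; 0, 0, 1, 0] := by
    refine ⟨A' 0 0, A' 0 1, A' 0 2, A' 0 3, ?_⟩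
    ext i j
    fin_cases i <;> fin_cases j <;> simp [hr1, hr2, hr3]
  have hcube := h'.cube
  rw [hAeq] at hcube ho
  have e00 := congrFun (congrFun hcube 0) 0
  have e01 := congrFun (congrFun hcube 0) 1
  simp [Matrix.mul_apply, Fin.sum_univ_four] at e00 e01
  subst e00
  simp at e01
  subst e01
  -- The cube being zero has removed the coefficients of `w` and `v` from `wA`, so `wA = a vA² + b
  -- vA`, and `w - a vA - b v` is killed by `A`.
  refine type14_mem_orbit_trans ho (type14_mem_orbit_of_basis
    (Q := !![0, 1, 0, 0; 0, 0, 1, 0; 0, 0, 0, 1; 1, 0, -a, -b]) ?_ ?_ (by simp))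
  · simp [det_succ_row_zero, Fin.sum_univ_succ, Fin.succAbove]
  · rw [oddMatrix_14_7]
    ext i j
    fin_cases i <;> fin_cases j <;> simp [Matrix.mul_apply, Fin.sum_univ_four]

lemma mem_closure_14_7_of_form_eq_zero {A : Matrix (Fin 4) (Fin 4) ℂ} (h : IsNJ A 0) :
    type14 A 0 ∈ closure (orbit J14_7) := by
  by_cases hsq : A * A = 0
  swap
  · exact subset_closure (mem_orbit_14_7_of_square_ne_zero h hsq)
  -- For `A ≠ 0` the perturbation is `x ↦ φ(x) u`, where `uA = 0`, `φ(u) = 0` and `φ(vA) ≠ 0`. Then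
  -- `NA = N² = 0`, so `(A + sN)² = s AN` sends `v` to `s φ(vA) u ≠ 0`, and the cube vanishes. Such
  -- `u` and `φ` exist because the kernel contains the image, hence has dimension at least 2 and a
  -- vector independent of `vA`.
  obtain ⟨N, hN⟩ : ∃ N : Matrix (Fin 4) (Fin 4) ℂ, ∀ s : ℂ, s ≠ 0 →
      (A + s • N) * (A + s • N) ≠ 0 ∧ (A + s • N) * (A + s • N) * (A + s • N) = 0 := by
    by_cases hA : A = 0
    · refine ⟨Matrix.single 1 0 1 + Matrix.single 2 1 1, fun s hs => ?_⟩
      rw [hA, zero_add, oddMatrix_14_7]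
      constructor
      · intro h0
        have := congrFun (congrFun h0 2) 0
        simp [Matrix.mul_apply, Fin.sum_univ_four, hs] at this
      · ext i j
        fin_cases i <;> fin_cases j <;> simp [Matrix.mul_apply, Fin.sum_univ_four]
    · obtain ⟨v, hv⟩ : ∃ v, v ᵥ* A ≠ 0 := by
        by_contra! hv
        apply hA
        ext i j
        have := congrFun (hv (Pi.single i 1)) j
        rwa [single_one_vecMul] at this
      have hvA : v ᵥ* A ∈ LinearMap.ker A.vecMulLinear := by simp [vecMul_vecMul, hsq]
      have hfin : 1 < Module.finrank ℂ (LinearMap.ker A.vecMulLinear) := by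
        have h1 := LinearMap.finrank_range_add_finrank_ker A.vecMulLinear
        have h2 : LinearMap.range A.vecMulLinear ≤ LinearMap.ker A.vecMulLinear := by
          rintro _ ⟨x, rfl⟩
          simp [vecMul_vecMul, hsq]
        have h3 := Submodule.finrank_mono h2
        simp only [Module.finrank_fintype_fun_eq_card, Fintype.card_fin] at h1
        omega
      obtain ⟨⟨u, hu⟩, hvu⟩ := exists_linearIndependent_pair_of_one_lt_finrank hfin
        (x := ⟨v ᵥ* A, hvA⟩) (fun h0 => hv (congrArg Subtype.val h0))
      rw [LinearIndependent.pair_iff] at hvu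
      have hvu : ∀ a b : ℂ, a • (v ᵥ* A) + b • u = 0 → a = 0 ∧ b = 0 := fun a b hab =>
        hvu a b (Subtype.ext hab)
      have huA : u ᵥ* A = 0 := hu
      have hu0 : u ≠ 0 := by
        rintro rfl
        simpa using hvu 0 1 (by simp)
      obtain ⟨f, hf, hfu⟩ := Submodule.exists_dual_map_eq_bot_of_notMem
        (p := Submodule.span ℂ {u}) (x := v ᵥ* A) (fun hmem => by
          obtain ⟨a, ha⟩ := Submodule.mem_span_singleton.1 hmem
          simpa using hvu 1 (-a) (by rw [ha.symm]; simp)) inferInstance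
      obtain ⟨φ, hφ⟩ : ∃ φ : Fin 4 → ℂ, ∀ x, f x = x ⬝ᵥ φ := by
        refine ⟨fun i => f (Pi.single i 1), fun x => ?_⟩
        conv_lhs => rw [← (Pi.basisFun ℂ (Fin 4)).sum_repr x]
        simp [dotProduct]
      have hφu : u ⬝ᵥ φ = 0 := by
        rw [← hφ, ← Submodule.mem_bot ℂ, ← hfu]
        exact Submodule.mem_map_of_mem (Submodule.mem_span_singleton_self u)
      rw [hφ] at hf
      have hNA : vecMulVec φ u * A = 0 := by rw [vecMulVec_mul, huA, vecMulVec_zero]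
      have hNN : vecMulVec φ u * vecMulVec φ u = 0 := by
        rw [vecMulVec_mul_vecMulVec, hφu]
        simp
      refine ⟨vecMulVec φ u, fun s hs => ?_⟩
      have hsq' : (A + s • vecMulVec φ u) * (A + s • vecMulVec φ u) =
          s • vecMulVec (A *ᵥ φ) u := by
        simp [add_mul, mul_add, hsq, hNA, hNN, mul_vecMulVec]
      rw [hsq']
      constructor
      · intro h0
        have h1 : vecMulVec (A *ᵥ φ) u = 0 := by simpa [hs] using h0
        have h2 := congrArg (fun M => v ᵥ* M) h1
        simp only [vecMul_vecMulVec, vecMul_zero, dotProduct_mulVec] at h2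
        simp [hf, hu0] at h2
      · rw [smul_mul_assoc, mul_add, vecMulVec_mul, huA, mul_smul_comm, vecMulVec_mul_vecMulVec, hφu]
        simp
  have hcurve := isPolyCurve_type14
    (A.map Polynomial.C + (Polynomial.X : Polynomial ℂ) • N.map Polynomial.C) 0
  have := hcurve.mem_closure (S := orbit J14_7) (D := Polynomial.X) Polynomial.X_ne_zero
    (fun s hs => ?_) 0
  · simpa [evalMatrix_smul, evalMatrix_map_C] using this
  · rw [Polynomial.eval_X] at hs
    rw [map_add, evalMatrix_smul, evalMatrix_map_C, evalMatrix_map_C, Polynomial.eval_X, map_zero]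
    exact mem_orbit_14_7_of_square_ne_zero
      ⟨by simp, (hN s hs).2, by simp, Or.inr rfl⟩ (hN s hs).1

/-- On the segment from `B` to a nondegenerate skew form, the determinant is generically nonzero. -/
lemma mem_closure_14_3_of_oddMatrix_eq_zero {B : Matrix (Fin 4) (Fin 4) ℂ} (hB : Bᵀ = -B) :
    type14 0 B ∈ closure (orbit J14_3) := by
  let N : Matrix (Fin 4) (Fin 4) ℂ := skew 0 1 + skew 2 3
  have hN : Nᵀ = -N := by
    ext i j
    fin_cases i <;> fin_cases j <;> simp [N, skew, Matrix.single]
  let C : Matrix (Fin 4) (Fin 4) (Polynomial ℂ) :=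
    (1 - Polynomial.X : Polynomial ℂ) • B.map Polynomial.C +
      (Polynomial.X : Polynomial ℂ) • N.map Polynomial.C
  have hC : ∀ s, evalMatrix s C = (1 - s) • B + s • N := fun s => by
    simp [C, evalMatrix_smul, evalMatrix_map_C]
  have := (isPolyCurve_type14 0 C).mem_closure (S := orbit J14_3) (D := C.det) (fun h0 => ?_)
    (fun s hs => ?_) 0
  · simpa [hC] using this
  · have := congrArg (Polynomial.eval 1) h0
    rw [eval_det, hC] at this
    have hN' : N = !![0, 1, 0, 0; -1, 0, 0, 0; 0, 0, 0, 1; 0, 0, -1, 0] := by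
      ext i j
      fin_cases i <;> fin_cases j <;> simp [N, skew, Matrix.single]
    rw [hN'] at this
    simp [det_succ_row_zero, Fin.sum_univ_succ, Fin.succAbove] at this
  · rw [eval_det] at hs
    rw [map_zero]
    refine mem_orbit_14_3_of_det_ne_zero ⟨?_, by simp, by simp, by simp⟩ hs
    rw [hC]
    simp [hB, hN, add_comm]

/-! ### Invariants that characterize the four orbits. -/

lemma square_eq_zero_of_mem_orbit {A B A₀ B₀ : Matrix (Fin 4) (Fin 4) ℂ}
    (h : type14 A B ∈ orbit (type14 A₀ B₀)) (hA : A * A = 0) : A₀ * A₀ = 0 := by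
  obtain ⟨t, ht, P, hP, h1, -⟩ := type14_mem_orbit_iff.1 h
  have h2 : P * (A₀ * A₀) = 0 := by
    rw [← mul_assoc, ← h1, smul_mul_assoc, mul_assoc, ← h1, mul_smul_comm, ← mul_assoc, hA]
    simp
  have := congrArg (P⁻¹ * ·) h2
  simpa [nonsing_inv_mul_cancel_left _ _ hP.isUnit] using this

lemma form_eq_zero_of_mem_orbit {A B A₀ B₀ : Matrix (Fin 4) (Fin 4) ℂ}
    (h : type14 A B ∈ orbit (type14 A₀ B₀)) (hB : B₀ = 0) : B = 0 := by
  obtain ⟨t, ht, P, hP, -, rfl⟩ := type14_mem_orbit_iff.1 h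
  simp [hB]

/-- The trilinear map `ω ∧ L` vanishes, where `ω` is the product of odd elements and `L` the
multiplication by `e_1`. -/
def WedgeVanishes (A B : Matrix (Fin 4) (Fin 4) ℂ) : Prop :=
  ∀ i j k l, B i j * A k l + B j k * A i l + B k i * A j l = 0

/-- Trilinearity, one argument at a time, extends the identity from basis vectors to all vectors;
this makes its invariance under change of basis visible. -/
lemma WedgeVanishes.vector {A B : Matrix (Fin 4) (Fin 4) ℂ} (h : WedgeVanishes A B)
    (x y z : Fin 4 → ℂ) :
    (x ⬝ᵥ B *ᵥ y) • (z ᵥ* A) + (y ⬝ᵥ B *ᵥ z) • (x ᵥ* A) + (z ⬝ᵥ B *ᵥ x) • (y ᵥ* A) = 0 := by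
  ext l
  have h1 : ∀ j k, (x ⬝ᵥ B.col j) * A k l + B j k * (x ⬝ᵥ A.col l) + (B.row k ⬝ᵥ x) * A j l = 0 := by
    intro j k
    simp only [dotProduct, Fin.sum_univ_four, Matrix.row_apply, Matrix.col_apply]
    linear_combination x 0 * h 0 j k l + x 1 * h 1 j k l + x 2 * h 2 j k l + x 3 * h 3 j k l
  have h2 : ∀ k, (x ⬝ᵥ B *ᵥ y) * A k l + (y ⬝ᵥ B.col k) * (x ⬝ᵥ A.col l) +
      (B.row k ⬝ᵥ x) * (y ⬝ᵥ A.col l) = 0 := by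
    intro k
    have hx : x ⬝ᵥ B *ᵥ y = ∑ j, (x ⬝ᵥ B.col j) * y j := by
      rw [dotProduct_mulVec]
      rfl
    rw [hx]
    have hd : ∀ w, y ⬝ᵥ w = ∑ j, y j * w j := fun w => rfl
    simp only [hd, Fin.sum_univ_four, Matrix.col_apply]
    linear_combination y 0 * h1 0 k + y 1 * h1 1 k + y 2 * h1 2 k + y 3 * h1 3 k
  have hy : y ⬝ᵥ B *ᵥ z = ∑ k, (y ⬝ᵥ B.col k) * z k := by
    rw [dotProduct_mulVec]
    rfl
  have hz : z ⬝ᵥ B *ᵥ x = ∑ k, z k * (B.row k ⬝ᵥ x) := rfl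
  have hA : ∀ u : Fin 4 → ℂ, (u ᵥ* A) l = u ⬝ᵥ A.col l := fun u => rfl
  simp only [Pi.add_apply, Pi.smul_apply, Pi.zero_apply, smul_eq_mul, hA, hy, hz]
  have hd : ∀ w, z ⬝ᵥ w = ∑ j, z j * w j := fun w => rfl
  simp only [hd, Fin.sum_univ_four, Matrix.col_apply]
  linear_combination z 0 * h2 0 + z 1 * h2 1 + z 2 * h2 2 + z 3 * h2 3

lemma WedgeVanishes.of_mem_orbit {A B A₀ B₀ : Matrix (Fin 4) (Fin 4) ℂ}
    (h₀ : WedgeVanishes A₀ B₀) (h : type14 A B ∈ orbit (type14 A₀ B₀)) : WedgeVanishes A B := by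
  obtain ⟨t, ht, P, hP, h1, rfl⟩ := type14_mem_orbit_iff.1 h
  intro i j k l
  have hA : A = t⁻¹ • (P * A₀ * P⁻¹) := by
    rw [← h1, smul_mul_assoc, smul_smul, inv_mul_cancel₀ ht, one_smul,
      mul_nonsing_inv_cancel_right _ _ hP.isUnit]
  have hv := congrArg (· ᵥ* P⁻¹) (h₀.vector (P i) (P j) (P k))
  have hv := congrFun hv l
  simp only [add_vecMul, smul_vecMul, zero_vecMul] at hv
  have hB : ∀ i j, (P * B₀ * Pᵀ) i j = P i ⬝ᵥ B₀ *ᵥ P j := fun i j => by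
    rw [dotProduct_mulVec]
    rfl
  have hA' : ∀ i, (P * A₀ * P⁻¹) i l = (P i ᵥ* A₀ ᵥ* P⁻¹) l := fun i => rfl
  rw [hA]
  simp only [Matrix.smul_apply, smul_eq_mul, hB, hA']
  simp only [Pi.add_apply, Pi.smul_apply, Pi.zero_apply, smul_eq_mul] at hv
  field_simp
  exact hv

/-- All `2 × 2` minors of the matrix vanish. -/
def MinorsVanish (A : Matrix (Fin 4) (Fin 4) ℂ) : Prop :=
  ∀ i j k l, A i j * A k l - A i l * A k j = 0

lemma minorsVanish_vecMulVec (u v : Fin 4 → ℂ) : MinorsVanish (vecMulVec u v) := by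
  intro i j k l
  simp only [vecMulVec_apply]
  ring

lemma MinorsVanish.exists_eq_vecMulVec {A : Matrix (Fin 4) (Fin 4) ℂ} (h : MinorsVanish A) :
    ∃ u v, A = vecMulVec u v := by
  by_cases hA : ∃ i j, A i j ≠ 0
  · obtain ⟨i, j, hij⟩ := hA
    refine ⟨fun k => A k j / A i j, A i, ?_⟩
    ext k l
    rw [vecMulVec_apply]
    field_simp
    linear_combination h i j k l
  · push Not at hA
    exact ⟨0, 0, by ext i j; simp [hA]⟩

lemma MinorsVanish.of_mem_orbit {A B A₀ B₀ : Matrix (Fin 4) (Fin 4) ℂ}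
    (h₀ : MinorsVanish A₀) (h : type14 A B ∈ orbit (type14 A₀ B₀)) : MinorsVanish A := by
  obtain ⟨t, ht, P, hP, h1, -⟩ := type14_mem_orbit_iff.1 h
  have hA : A = t⁻¹ • (P * A₀ * P⁻¹) := by
    rw [← h1, smul_mul_assoc, smul_smul, inv_mul_cancel₀ ht, one_smul,
      mul_nonsing_inv_cancel_right _ _ hP.isUnit]
  obtain ⟨u, v, rfl⟩ := h₀.exists_eq_vecMulVec
  rw [hA, mul_vecMulVec, vecMulVec_mul, ← smul_vecMulVec]
  exact minorsVanish_vecMulVec _ _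

lemma wedgeVanishes_lowerLeft (p q p' q' : ℂ) :
    WedgeVanishes (lowerLeft p q p' q') (skew 2 3) := by
  rw [skew_two_three]
  intro i j k l
  fin_cases i <;> fin_cases j <;> fin_cases k <;> simp [lowerLeft] <;>
    fin_cases l <;> rfl

lemma not_wedgeVanishes_14_6 : ¬ WedgeVanishes (Matrix.single 1 0 1) (skew 2 3) := by
  intro h
  simpa [skew, Matrix.single] using h 2 3 1 0

lemma not_minorsVanish_14_9 : ¬ MinorsVanish (Matrix.single 1 0 1 + Matrix.single 3 2 1) := by
  intro h
  simpa [Matrix.single] using h 1 0 3 2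

theorem mem_orbit_14_3_iff {A B : Matrix (Fin 4) (Fin 4) ℂ} (h : IsNJ A B) :
    type14 A B ∈ orbit J14_3 ↔ B.det ≠ 0 := by
  refine ⟨fun ho => ?_, mem_orbit_14_3_of_det_ne_zero h⟩
  obtain ⟨t, ht, P, hP, -, rfl⟩ := type14_mem_orbit_iff.1 ho
  have hN : skew 0 1 + skew 2 3 = !![0, 1, 0, 0; -1, 0, 0, 0; 0, 0, 0, 1; 0, 0, -1, 0] := by
    ext i j
    fin_cases i <;> fin_cases j <;> simp [skew, Matrix.single]
  have h1 : (skew 0 1 + skew 2 3 : Matrix (Fin 4) (Fin 4) ℂ).det = 1 := by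
    rw [hN]
    simp [det_succ_row_zero, Fin.sum_univ_succ, Fin.succAbove]
  simp [h1, ht, hP]

theorem mem_orbit_14_7_iff {A B : Matrix (Fin 4) (Fin 4) ℂ} (h : IsNJ A B) :
    type14 A B ∈ orbit J14_7 ↔ A * A ≠ 0 := by
  refine ⟨fun ho hA => ?_, mem_orbit_14_7_of_square_ne_zero h⟩
  have := square_eq_zero_of_mem_orbit ho hA
  rw [oddMatrix_14_7] at this
  simpa [Matrix.mul_apply, Fin.sum_univ_four] using congrFun (congrFun this 2) 0

/-- For a form `ω` of rank 2, `ω ∧ L = 0` says that `L` kills the radical of `ω`. That is exactly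
what separates the lower left normal form from `J14_6`. -/
theorem mem_orbit_14_6_iff {A B : Matrix (Fin 4) (Fin 4) ℂ} (h : IsNJ A B) :
    type14 A B ∈ orbit J14_6 ↔ ¬ WedgeVanishes A B := by
  refine ⟨fun ho hw => not_wedgeVanishes_14_6 (hw.of_mem_orbit (type14_mem_orbit_symm ho)),
    fun hw => ?_⟩
  have hA : A ≠ 0 := by
    rintro rfl
    exact hw fun i j k l => by simp
  have hB : B ≠ 0 := by
    rintro rfl
    exact hw fun i j k l => by simp
  obtain ⟨A', ho, h'⟩ := exists_normal_form h hA hB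
  obtain h6 | ⟨p, q, p', q', rfl⟩ := mem_orbit_14_6_or_eq_lowerLeft h'
  · exact type14_mem_orbit_trans ho h6
  · exact absurd ((wedgeVanishes_lowerLeft _ _ _ _).of_mem_orbit ho) hw

lemma minorsVanish_lowerLeft {p q p' q' : ℂ} (h : p * q' - q * p' = 0) :
    MinorsVanish (lowerLeft p q p' q') := by
  intro i j k l
  fin_cases i <;> fin_cases k <;> fin_cases j <;> fin_cases l <;> simp [lowerLeft] <;>
    first | ring1 | linear_combination h | linear_combination -h

/-- When `A` and `B` are both nonzero, the alternatives to this orbit are that of `J14_6` and a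
singular lower left block; in both `A` has rank at most 1. -/
theorem mem_orbit_14_9_iff {A B : Matrix (Fin 4) (Fin 4) ℂ} (h : IsNJ A B) :
    type14 A B ∈ orbit J14_9 ↔ ¬ MinorsVanish A ∧ B ≠ 0 := by
  constructor
  · intro ho
    refine ⟨fun hm => not_minorsVanish_14_9 (hm.of_mem_orbit (type14_mem_orbit_symm ho)),
      fun hB => ?_⟩
    have := form_eq_zero_of_mem_orbit (type14_mem_orbit_symm ho) hB
    simpa [skew, Matrix.single] using congrFun (congrFun this 1) 3
  · rintro ⟨hm, hB⟩
    have hA : A ≠ 0 := by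
      rintro rfl
      exact hm fun i j k l => by simp
    obtain ⟨A', ho, h'⟩ := exists_normal_form h hA hB
    obtain h6 | ⟨p, q, p', q', rfl⟩ := mem_orbit_14_6_or_eq_lowerLeft h'
    · refine absurd (MinorsVanish.of_mem_orbit ?_ (type14_mem_orbit_trans ho h6)) hm
      rw [single_eq_single_vecMulVec_single]
      exact minorsVanish_vecMulVec _ _
    · by_cases hd : p * q' - q * p' = 0
      · exact absurd ((minorsVanish_lowerLeft hd).of_mem_orbit ho) hm
      · exact type14_mem_orbit_trans ho (lowerLeft_mem_orbit_14_9 hd)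

/-! ### Polynomial maps, and the covering by four closures. -/

/-- A family of matrices whose entries are polynomial functions of the structure constants. -/
def IsPolyMatrix (M : StructureConstants 1 4 → Matrix (Fin 4) (Fin 4) ℂ) : Prop :=
  ∀ i j, (fun J => M J i j) ∈ polyFun 1 4

lemma isPolyMatrix_oddMatrix : IsPolyMatrix oddMatrix := fun i j =>
  coords_mem_polyFun (.inr (.inl (0, i, j)))

lemma isPolyMatrix_formMatrix : IsPolyMatrix formMatrix := fun i j =>
  coords_mem_polyFun (.inr (.inr (i, j, 0)))

lemma const_mem_polyFun (a : ℂ) : (fun _ => a) ∈ polyFun 1 4 := (polyFun 1 4).algebraMap_mem a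

lemma isPolyMatrix_const (M : Matrix (Fin 4) (Fin 4) ℂ) : IsPolyMatrix fun _ => M :=
  fun i j => const_mem_polyFun (M i j)

lemma IsPolyMatrix.mul {M N : StructureConstants 1 4 → Matrix (Fin 4) (Fin 4) ℂ}
    (hM : IsPolyMatrix M) (hN : IsPolyMatrix N) : IsPolyMatrix fun J => M J * N J := by
  intro i j
  simp only [Matrix.mul_apply, Fin.sum_univ_four]
  have h := fun k => (polyFun 1 4).mul_mem (hM i k) (hN k j)
  exact add_mem (add_mem (add_mem (h 0) (h 1)) (h 2)) (h 3)

lemma IsPolyMatrix.smul {M : StructureConstants 1 4 → Matrix (Fin 4) (Fin 4) ℂ}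
    (hM : IsPolyMatrix M) (a : ℂ) : IsPolyMatrix fun J => a • M J := fun i j =>
  (polyFun 1 4).smul_mem (hM i j) a

lemma IsPolyMatrix.det_mem {M : StructureConstants 1 4 → Matrix (Fin 4) (Fin 4) ℂ}
    (hM : IsPolyMatrix M) : (fun J => (M J).det) ∈ polyFun 1 4 := by
  have : (fun J => (M J).det) = ∑ σ : Equiv.Perm (Fin 4),
      ((Equiv.Perm.sign σ : ℤ) : StructureConstants 1 4 → ℂ) * ∏ i, fun J => M J (σ i) i := by
    ext J
    simp [Matrix.det_apply']
  rw [this]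
  exact sum_mem fun σ _ => mul_mem (intCast_mem _ _) (prod_mem fun i _ => hM _ _)

lemma polyFun_comp {Φ : StructureConstants 1 4 → StructureConstants 1 4}
    (hΦ : ∀ i, (fun J => (Φ J).coords i) ∈ polyFun 1 4) (p : MvPolynomial (Coord 1 4) ℂ) :
    (fun J => MvPolynomial.eval (Φ J).coords p) ∈ polyFun 1 4 := by
  induction p using MvPolynomial.induction_on with
  | C a => simpa using const_mem_polyFun a
  | add p q hp hq =>
    simp only [map_add]
    exact add_mem hp hq
  | mul_X p i hp =>
    simp only [map_mul, MvPolynomial.eval_X]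
    exact mul_mem hp (hΦ i)

lemma mem_closure_of_polyMap {Φ : StructureConstants 1 4 → StructureConstants 1 4}
    (hΦ : ∀ i, (fun J => (Φ J).coords i) ∈ polyFun 1 4) {S T : Set (StructureConstants 1 4)}
    (hST : ∀ J ∈ S, Φ J ∈ T) {J : StructureConstants 1 4} (hJ : J ∈ closure S) :
    Φ J ∈ closure T :=
  mem_closure_iff.2 fun p hp =>
    closure_minimal (fun K hK => hp _ (hST K hK)) (isClosed_setOf_polyFun (polyFun_comp hΦ p)) hJ

lemma type14_coords_mem_polyFun {M N : StructureConstants 1 4 → Matrix (Fin 4) (Fin 4) ℂ}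
    (hM : IsPolyMatrix M) (hN : IsPolyMatrix N) :
    ∀ i, (fun J => (type14 (M J) (N J)).coords i) ∈ polyFun 1 4
  | .inl _ => const_mem_polyFun 0
  | .inr (.inl (_, i, j)) => hM i j
  | .inr (.inr (i, j, _)) => hN i j

/-- A fixed change of basis is a polynomial map preserving the orbit, so it preserves the closure of
the orbit. -/
lemma mem_closure_of_mem_orbit {A B A' B' A₀ B₀ : Matrix (Fin 4) (Fin 4) ℂ}
    (h : type14 A' B' ∈ closure (orbit (type14 A₀ B₀))) (ho : type14 A B ∈ orbit (type14 A' B')) :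
    type14 A B ∈ closure (orbit (type14 A₀ B₀)) := by
  obtain ⟨t, ht, P, hP, h1, rfl⟩ := type14_mem_orbit_iff.1 ho
  have hA : A = t⁻¹ • (P * A' * P⁻¹) := by
    rw [← h1, smul_mul_assoc, smul_smul, inv_mul_cancel₀ ht, one_smul,
      mul_nonsing_inv_cancel_right _ _ hP.isUnit]
  have hM := (((isPolyMatrix_const P).mul isPolyMatrix_oddMatrix).mul
    (isPolyMatrix_const P⁻¹)).smul t⁻¹
  have hN := (((isPolyMatrix_const P).mul isPolyMatrix_formMatrix).mul
    (isPolyMatrix_const Pᵀ)).smul t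
  have hST : ∀ J ∈ orbit (type14 A₀ B₀), type14 (t⁻¹ • (P * oddMatrix J * P⁻¹))
      (t • (P * formMatrix J * Pᵀ)) ∈ orbit (type14 A₀ B₀) := by
    intro J hJ
    obtain ⟨A₁, B₁, rfl, -⟩ := mem_orbit_type14_iff.1 hJ
    refine type14_mem_orbit_trans (type14_mem_orbit_iff.2 ⟨t, ht, P, hP, ?_, rfl⟩) hJ
    rw [oddMatrix_type14, smul_mul_assoc, mul_assoc _ P⁻¹, nonsing_inv_mul _ hP.isUnit, mul_one,
      smul_smul, mul_inv_cancel₀ ht, one_smul]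
  have := mem_closure_of_polyMap (type14_coords_mem_polyFun hM hN) hST h
  rwa [oddMatrix_type14, formMatrix_type14, ← hA] at this

theorem IsNJ.mem_closure {A B : Matrix (Fin 4) (Fin 4) ℂ} (h : IsNJ A B) :
    type14 A B ∈ closure (orbit J14_3) ∨ type14 A B ∈ closure (orbit J14_6) ∨
      type14 A B ∈ closure (orbit J14_7) ∨ type14 A B ∈ closure (orbit J14_9) := by
  by_cases hA : A = 0
  · subst hA
    exact Or.inl (mem_closure_14_3_of_oddMatrix_eq_zero h.skew)
  by_cases hB : B = 0
  · subst hB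
    exact Or.inr (Or.inr (Or.inl (mem_closure_14_7_of_form_eq_zero h)))
  obtain ⟨A', ho, h'⟩ := exists_normal_form h hA hB
  obtain h6 | ⟨p, q, p', q', rfl⟩ := mem_orbit_14_6_or_eq_lowerLeft h'
  · exact Or.inr (Or.inl (subset_closure (type14_mem_orbit_trans ho h6)))
  · exact Or.inr (Or.inr (Or.inr (mem_closure_of_mem_orbit (lowerLeft_mem_closure _ _ _ _) ho)))

/-! ### Irreducible components from disjoint open irreducible subsets. -/

section Components

variable {Y ι : Type*} [TopologicalSpace Y]

lemma isIrreducible_preimage_val {X S : Set Y} (hS : IsIrreducible S) (h : S ⊆ X) :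
    IsIrreducible ((↑) ⁻¹' S : Set X) := by
  obtain ⟨⟨x, hx⟩, hp⟩ := hS
  refine ⟨⟨⟨x, h hx⟩, hx⟩, ?_⟩
  rintro u v ⟨u', hu', rfl⟩ ⟨v', hv', rfl⟩ ⟨a, ha, hau⟩ ⟨b, hb, hbv⟩
  obtain ⟨c, hc, hcuv⟩ := hp u' v' hu' hv' ⟨a, ha, hau⟩ ⟨b, hb, hbv⟩
  exact ⟨⟨c, h hc⟩, hc, hcuv⟩

/-- If a closed subspace is the union of the closures of finitely many pairwise disjoint
irreducible relatively open subsets, then these closures are its irreducible components. -/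
theorem irreducibleComponents_of_open_cover [Finite ι] {X : Set Y} (hX : IsClosed X)
    {O : ι → Set Y} (hO : ∀ i, IsIrreducible (O i)) (hOX : ∀ i, O i ⊆ X)
    (hcover : X ⊆ ⋃ i, closure (O i)) (hopen : ∀ i, IsOpen ((↑) ⁻¹' O i : Set X))
    (hdisj : Pairwise fun i j => Disjoint (O i) (O j)) :
    Set.image Subtype.val '' irreducibleComponents X = Set.range (fun i => closure (O i)) ∧
      (irreducibleComponents X).ncard = Nat.card ι := by
  let D : ι → Set X := fun i => (↑) ⁻¹' closure (O i)
  have hD : ∀ i, D i = closure ((↑) ⁻¹' O i) := fun i => by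
    rw [Topology.IsInducing.subtypeVal.closure_eq_preimage_closure_image,
      Subtype.image_preimage_coe, Set.inter_eq_right.2 (hOX i)]
  have hDirr : ∀ i, IsIrreducible (D i) := fun i => by
    rw [hD, isIrreducible_iff_closure]
    exact isIrreducible_preimage_val (hO i) (hOX i)
  have hDcl : ∀ i, IsClosed (D i) := fun i => by
    rw [hD]
    exact isClosed_closure
  -- A point of `O i` lying in the closure of `O j` would make the open set `O i` meet `O j`.
  have hanti : ∀ i j, D i ⊆ D j → i = j := by
    intro i j hij
    by_contra hne
    obtain ⟨x, hx⟩ := (hO i).nonempty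
    have hxj : (⟨x, hOX i hx⟩ : X) ∈ closure ((↑) ⁻¹' O j : Set X) := by
      rw [← hD]
      exact hij (subset_closure hx)
    obtain ⟨y, hyi, hyj⟩ := _root_.mem_closure_iff.1 hxj _ (hopen i) hx
    exact Set.disjoint_left.1 (hdisj hne) hyi hyj
  have hle : ∀ s : Set X, IsIrreducible s → ∃ i, s ⊆ D i := by
    intro s hs
    cases nonempty_fintype ι
    classical
    obtain ⟨z, hz, hsz⟩ := isIrreducible_iff_sUnion_isClosed.1 hs (Finset.univ.image D)
      (by simpa using hDcl) (by
        intro x _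
        obtain ⟨i, hi⟩ := Set.mem_iUnion.1 (hcover x.2)
        exact Set.mem_sUnion.2 ⟨D i, by simp, hi⟩)
    obtain ⟨i, -, rfl⟩ := Finset.mem_image.1 hz
    exact ⟨i, hsz⟩
  have hcomp : irreducibleComponents X = Set.range D := by
    ext s
    constructor
    · intro hs
      obtain ⟨i, hi⟩ := hle s hs.1
      exact ⟨i, le_antisymm (hs.2 (hDirr i) hi) hi⟩
    · rintro ⟨i, rfl⟩
      refine ⟨hDirr i, fun t ht hit => ?_⟩
      obtain ⟨j, hj⟩ := hle t ht
      obtain rfl := hanti i j (le_trans hit hj)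
      exact hj
  rw [hcomp]
  constructor
  · rw [← Set.range_comp]
    congr 1
    ext1 i
    exact (Subtype.image_preimage_coe _ _).trans
      (Set.inter_eq_right.2 (closure_minimal (hOX i) hX))
  · exact Set.ncard_range_of_injective fun i j hij => hanti i j hij.le

end Components

/-! ### The four orbits are open in the closed variety and pairwise disjoint. -/

lemma isClosed_setOf_forall_polyFun {ι : Type*} {F : ι → StructureConstants 1 4 → ℂ}
    (hF : ∀ i, F i ∈ polyFun 1 4) : IsClosed {J | ∀ i, F i J = 0} := by
  rw [Set.ofPred_forall]
  exact isClosed_iInter fun i => isClosed_setOf_polyFun (hF i)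

lemma IsPolyMatrix.isClosed {M : StructureConstants 1 4 → Matrix (Fin 4) (Fin 4) ℂ}
    (hM : IsPolyMatrix M) : IsClosed {J | M J = 0} := by
  convert isClosed_setOf_forall_polyFun (F := fun (i : Fin 4 × Fin 4) J => M J i.1 i.2)
    (fun i => hM i.1 i.2) using 3 with J
  exact ⟨fun h i => by rw [h]; rfl, fun h => by ext i j; exact h (i, j)⟩

lemma isClosed_NJS : IsClosed (NJS 1 4) := by
  have hA := isPolyMatrix_oddMatrix
  have hB := isPolyMatrix_formMatrix
  have hskew : IsPolyMatrix fun J => (formMatrix J)ᵀ + formMatrix J := fun i j =>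
    add_mem (hB j i) (hB i j)
  have h := (((isClosed_setOf_polyFun (coords_mem_polyFun (m := 1) (n := 4)
    (.inl (0, 0, 0)))).inter hskew.isClosed).inter ((hA.mul hA).mul hA).isClosed).inter
    ((hA.mul hB).isClosed.inter ((hA.mul hA).isClosed.union hB.isClosed))
  convert h using 1
  ext J
  rw [mem_NJS_iff]
  constructor
  · rintro ⟨hc, h⟩
    exact ⟨⟨⟨hc, by simp [h.skew]⟩, h.cube⟩, h.mul_form, h.square⟩
  · rintro ⟨⟨⟨hc, h1⟩, h2⟩, h3, h4⟩
    exact ⟨hc, eq_neg_of_add_eq_zero_left h1, h2, h3, h4⟩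

/-- The orbits `O((1,4)_3)`, `O((1,4)_6)`, `O((1,4)_7)`, `O((1,4)_9)`. -/
def openOrbit : Fin 4 → Set (StructureConstants 1 4) :=
  ![orbit J14_3, orbit J14_6, orbit J14_7, orbit J14_9]

/-- The matrices `A`, `B` of the representatives of the open orbits. -/
def openRep : Fin 4 → Matrix (Fin 4) (Fin 4) ℂ × Matrix (Fin 4) (Fin 4) ℂ :=
  ![(0, skew 0 1 + skew 2 3), (Matrix.single 1 0 1, skew 2 3),
    (Matrix.single 1 0 1 + Matrix.single 2 1 1, 0),
    (Matrix.single 1 0 1 + Matrix.single 3 2 1, skew 1 3)]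

lemma openOrbit_eq (i : Fin 4) : openOrbit i = orbit (type14 (openRep i).1 (openRep i).2) := by
  fin_cases i <;> rfl

lemma isNJ_openRep (i : Fin 4) : IsNJ (openRep i).1 (openRep i).2 := by
  fin_cases i
  · exact ⟨by simp [openRep, skew, add_comm], by simp [openRep], by simp [openRep], by simp [openRep]⟩
  · exact ⟨by simp [openRep, skew], by simp [openRep], by simp [openRep, skew, mul_sub],
      by simp [openRep]⟩
  · exact ⟨by simp [openRep], by simp [openRep, add_mul, mul_add], by simp [openRep],
      by simp [openRep]⟩
  · exact ⟨by simp [openRep, skew], by simp [openRep, add_mul, mul_add],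
      by simp [openRep, skew, mul_sub, add_mul], by simp [openRep, add_mul, mul_add]⟩

lemma isIrreducible_openOrbit (i : Fin 4) : IsIrreducible (openOrbit i) := by
  rw [openOrbit_eq]
  fin_cases i
  exacts [hasScaling_3.isIrreducible_orbit, hasScaling_6.isIrreducible_orbit,
    hasScaling_7.isIrreducible_orbit, hasScaling_9.isIrreducible_orbit]

lemma orbit_type14_subset_NJS {A B : Matrix (Fin 4) (Fin 4) ℂ} (h : IsNJ A B) :
    orbit (type14 A B) ⊆ NJS 1 4 := by
  intro J hJ
  obtain ⟨A', B', rfl, -⟩ := mem_orbit_type14_iff.1 hJ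
  exact type14_mem_NJS_iff.2 (h.of_mem_orbit hJ)

lemma openOrbit_subset_NJS (i : Fin 4) : openOrbit i ⊆ NJS 1 4 := by
  rw [openOrbit_eq]
  exact orbit_type14_subset_NJS (isNJ_openRep i)

lemma exists_of_mem_NJS {J : StructureConstants 1 4} (hJ : J ∈ NJS 1 4) :
    ∃ A B, J = type14 A B ∧ IsNJ A B :=
  have h := mem_NJS_iff.1 hJ
  ⟨_, _, eq_type14 h.1, h.2⟩

lemma NJS_subset_iUnion_closure : NJS 1 4 ⊆ ⋃ i, closure (openOrbit i) := by
  intro J hJ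
  obtain ⟨A, B, rfl, h⟩ := exists_of_mem_NJS hJ
  rw [Set.mem_iUnion]
  obtain h | h | h | h := h.mem_closure
  exacts [⟨0, h⟩, ⟨1, h⟩, ⟨2, h⟩, ⟨3, h⟩]

lemma isOpen_of_isClosed {Z O : Set (StructureConstants 1 4)} (hZ : IsClosed Z)
    (h : ∀ A B, IsNJ A B → (type14 A B ∈ O ↔ type14 A B ∉ Z)) :
    IsOpen ((↑) ⁻¹' O : Set (NJS 1 4)) := by
  refine ⟨Zᶜ, hZ.isOpen_compl, ?_⟩
  ext ⟨J, hJ⟩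
  obtain ⟨A, B, rfl, hAB⟩ := exists_of_mem_NJS hJ
  exact (h A B hAB).symm

lemma isOpen_openOrbit (i : Fin 4) : IsOpen ((↑) ⁻¹' openOrbit i : Set (NJS 1 4)) := by
  have hA := isPolyMatrix_oddMatrix
  have hB := isPolyMatrix_formMatrix
  fin_cases i
  · exact isOpen_of_isClosed (isClosed_setOf_polyFun hB.det_mem)
      fun A B h => mem_orbit_14_3_iff h
  · refine isOpen_of_isClosed (Z := {J | WedgeVanishes (oddMatrix J) (formMatrix J)}) ?_
      fun A B h => mem_orbit_14_6_iff h
    simp only [WedgeVanishes, Set.ofPred_forall]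
    exact isClosed_iInter fun i => isClosed_iInter fun j => isClosed_iInter fun k =>
      isClosed_iInter fun l => isClosed_setOf_polyFun (add_mem (add_mem
        (mul_mem (hB i j) (hA k l)) (mul_mem (hB j k) (hA i l))) (mul_mem (hB k i) (hA j l)))
  · exact isOpen_of_isClosed (hA.mul hA).isClosed fun A B h => mem_orbit_14_7_iff h
  · refine isOpen_of_isClosed (Z := {J | MinorsVanish (oddMatrix J)} ∪ {J | formMatrix J = 0}) ?_
      fun A B h => (mem_orbit_14_9_iff h).trans not_or.symm
    refine IsClosed.union ?_ hB.isClosed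
    simp only [MinorsVanish, Set.ofPred_forall]
    exact isClosed_iInter fun i => isClosed_iInter fun j => isClosed_iInter fun k =>
      isClosed_iInter fun l => isClosed_setOf_polyFun
        (sub_mem (mul_mem (hA i j) (hA k l)) (mul_mem (hA i l) (hA k j)))

lemma openRep_notMem_openOrbit_zero {i : Fin 4} (hi : i ≠ 0) :
    type14 (openRep i).1 (openRep i).2 ∉ openOrbit 0 := by
  refine fun h => (mem_orbit_14_3_iff (isNJ_openRep i)).1 h
    (det_eq_zero_of_row_eq_zero 0 fun j => ?_)
  fin_cases i
  · exact absurd rfl hi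
  all_goals simp [openRep, skew, Matrix.single]

lemma openRep_notMem_openOrbit_two {i : Fin 4} (hi : i = 1 ∨ i = 3) :
    type14 (openRep i).1 (openRep i).2 ∉ openOrbit 2 := by
  refine fun h => (mem_orbit_14_7_iff (isNJ_openRep i)).1 h ?_
  obtain rfl | rfl := hi <;> simp [openRep, add_mul, mul_add]

lemma openRep_one_notMem_openOrbit_three :
    type14 (openRep 1).1 (openRep 1).2 ∉ openOrbit 3 := by
  refine fun h => ((mem_orbit_14_9_iff (isNJ_openRep 1)).1 h).1 ?_
  change MinorsVanish (Matrix.single 1 0 1)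
  rw [single_eq_single_vecMulVec_single]
  exact minorsVanish_vecMulVec _ _

/-- A common point would put each representative in the other orbit. The invariants `det B`, `A²`
and the rank of `A` rule this out in turn. -/
lemma pairwise_disjoint_openOrbit : Pairwise fun i j => Disjoint (openOrbit i) (openOrbit j) := by
  intro i j hij
  rw [Set.disjoint_left]
  intro J hi hj
  have key : ∀ i j, J ∈ openOrbit i → J ∈ openOrbit j →
      type14 (openRep i).1 (openRep i).2 ∈ openOrbit j := by
    intro i j hi hj
    rw [openOrbit_eq] at hi hj ⊢
    obtain ⟨A, B, rfl, -⟩ := mem_orbit_type14_iff.1 hi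
    exact type14_mem_orbit_trans (type14_mem_orbit_symm hi) hj
  have h1 := key i j hi hj
  have h2 := key j i hj hi
  by_cases hi0 : i = 0
  · subst hi0
    exact openRep_notMem_openOrbit_zero hij.symm h2
  by_cases hj0 : j = 0
  · subst hj0
    exact openRep_notMem_openOrbit_zero hij h1
  by_cases hi2 : i = 2
  · subst hi2
    exact openRep_notMem_openOrbit_two (by omega) h2
  by_cases hj2 : j = 2
  · subst hj2
    exact openRep_notMem_openOrbit_two (by omega) h1
  obtain ⟨rfl, rfl⟩ | ⟨rfl, rfl⟩ : i = 1 ∧ j = 3 ∨ i = 3 ∧ j = 1 := by omega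
  · exact openRep_one_notMem_openOrbit_three h1
  · exact openRep_one_notMem_openOrbit_three h2

/-! ### Rigidity and the main theorem. -/

theorem isRigidIn_NJS_iff (J : StructureConstants 1 4) :
    IsRigidIn (NJS 1 4) J ↔ ∃ i, J ∈ openOrbit i := by
  constructor
  · rintro ⟨hJ, -, U, hU, hUJ⟩
    obtain ⟨i, hi⟩ := Set.mem_iUnion.1 (NJS_subset_iUnion_closure hJ)
    obtain ⟨A, B, rfl, -⟩ := exists_of_mem_NJS hJ
    have hJU : type14 A B ∈ U := by
      have : (⟨type14 A B, hJ⟩ : NJS 1 4) ∈ ((↑) ⁻¹' orbit (type14 A B) : Set (NJS 1 4)) :=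
        type14_mem_orbit_self A B
      rwa [← hUJ] at this
    -- The orbit of `J` is open and `J` lies in the closure of `openOrbit i`, so the two orbits
    -- share a point `K` and coincide.
    obtain ⟨K, hKU, hK⟩ := _root_.mem_closure_iff.1 hi U hU hJU
    have hKJ : (⟨K, openOrbit_subset_NJS i hK⟩ : NJS 1 4) ∈ ((↑) ⁻¹' U : Set (NJS 1 4)) := hKU
    rw [hUJ] at hKJ
    have hKJ : K ∈ orbit (type14 A B) := hKJ
    refine ⟨i, ?_⟩
    rw [openOrbit_eq] at hK ⊢
    obtain ⟨A', B', rfl, -⟩ := mem_orbit_type14_iff.1 hK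
    exact type14_mem_orbit_trans (type14_mem_orbit_symm hKJ) hK
  · rintro ⟨i, hi⟩
    have hJ := openOrbit_subset_NJS i hi
    have ho : orbit J = openOrbit i := by
      rw [openOrbit_eq] at hi ⊢
      obtain ⟨A, B, rfl, -⟩ := mem_orbit_type14_iff.1 hi
      ext K
      constructor
      · intro hK
        obtain ⟨A', B', rfl, -⟩ := mem_orbit_type14_iff.1 hK
        exact type14_mem_orbit_trans hK hi
      · intro hK
        obtain ⟨A', B', rfl, -⟩ := mem_orbit_type14_iff.1 hK
        exact type14_mem_orbit_trans hK (type14_mem_orbit_symm hi)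
    rw [IsRigidIn, ho]
    exact ⟨hJ, openOrbit_subset_NJS i, isOpen_openOrbit i⟩

end JordanSuper

theorem mainTheorem6 :
    (Set.image Subtype.val '' irreducibleComponents (JordanSuper.NJS 1 4) =
      {closure (JordanSuper.orbit JordanSuper.J14_3),
       closure (JordanSuper.orbit JordanSuper.J14_6),
       closure (JordanSuper.orbit JordanSuper.J14_7),
       closure (JordanSuper.orbit JordanSuper.J14_9)}) ∧
    (irreducibleComponents (JordanSuper.NJS 1 4)).ncard = 4 ∧
    (∀ J : JordanSuper.StructureConstants 1 4,
      JordanSuper.IsRigidIn (JordanSuper.NJS 1 4) J ↔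
        J ∈ JordanSuper.orbit JordanSuper.J14_3 ∪ JordanSuper.orbit JordanSuper.J14_6 ∪
          JordanSuper.orbit JordanSuper.J14_7 ∪ JordanSuper.orbit JordanSuper.J14_9) := by
  obtain ⟨h1, h2⟩ := JordanSuper.irreducibleComponents_of_open_cover JordanSuper.isClosed_NJS
    JordanSuper.isIrreducible_openOrbit JordanSuper.openOrbit_subset_NJS
    JordanSuper.NJS_subset_iUnion_closure JordanSuper.isOpen_openOrbit
    JordanSuper.pairwise_disjoint_openOrbit
  refine ⟨?_, by simpa using h2, fun J => ?_⟩
  · rw [h1]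
    ext S
    simp [JordanSuper.openOrbit, Fin.exists_fin_succ, eq_comm]
  · rw [JordanSuper.isRigidIn_NJS_iff]
    simp [JordanSuper.openOrbit, Fin.exists_fin_succ, or_assoc]
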